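/- Let $\tilde g=-e^{\gamma(R)}dt^2+e^{\lambda(R)}dR^2+R^2d\Theta^2+R^2\sin^2\Theta\,d\varphi^2$ be a static spherically symmetric spacetime metric on $\{R>R_0\}$, $R_0>0$, with $\gamma,\lambda$ of class $C^2$, which is asymptotically flat with (ADM) mass $m\in\mathbb R$ in the sense that, as $R\to\infty$, $$e^{\lambda(R)}=1+\frac{2m}{R}+O\Big(\frac1{R^2}\Big),\qquad \frac{d}{dR}e^{\lambda(R)}=-\frac{2m}{R^2}+O\Big(\frac1{R^3}\Big).$$ Let $(x^1,x^2,x^3)=(R\sin\Theta\cos\varphi,R\sin\Theta\sin\varphi,R\cos\Theta)$, fix $b\ge 1$ and a time slice $\{t=t_0\}$, and for large $a$ let $\Sigma_a=\{(x^1)^2+(x^2)^2+(x^3)^2/b^2=a^2\}$ in this slice, with induced metric $\sigma$, area form $d\sigma$, area $|\Sigma_a|$ and scalar curvature $R_\sigma$. Let $e_0=e^{-\gamma/2}\partial_t$, let $e_1$ be the outward unit normal, within the time slices, of the ellipsoids $\Sigma_{a'}$, and let $l_\pm=\frac1{\sqrt2}(e_0\pm e_1)$. For $A,B$ tangential to $\Sigma_a$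 let $\theta_\pm=\frac12\sigma^{AB}(\mathcal L_{l_\pm}\tilde g)_{AB}$ be the null expansions, $\sigma^\pm_{AB}=(\mathcal L_{l_\pm}\tilde g)_{AB}-\theta_\pm\sigma_{AB}$ the shear tensors, and $\omega$ the projection of $[l_+,l_-]$ onto $\Sigma_a$. The Hawking and the Hayward mass are $$\mathfrak m_{\rm Hawking}(\Sigma_a)=\frac1{8\pi}\sqrt{\frac{|\Sigma_a|}{16\pi}}\int_{\Sigma_a}\big(R_\sigma+\theta_+\theta_-\big)d\sigma,$$ $$\mathfrak m_{\rm Hayward}(\Sigma_a)=\frac1{8\pi}\sqrt{\frac{|\Sigma_a|}{16\pi}}\int_{\Sigma_a}\Big(R_\sigma+\theta_+\theta_--\tfrac12\sigma^+_{AB}\sigma_-^{AB}-2\omega^A\omega_A\Big)d\sigma .$$ Then $$\lim_{a\to\infty}\mathfrak m_{\rm Hayward}(\Sigma_a)=\frac m4\sqrt{1+\frac{b^2}{\sqrt{b^2-1}}\arcsin\sqrt{\frac{b^2-1}{b^2}}}\int_0^\pi\frac{\big(2b^2-(1-b^2)^2\sin^2\theta\cos^2\theta\big)\sin\theta}{\sqrt{1+b^2+(1-b^2)\cos2\theta}\,(b^2\cos^2\theta+\sin^2\theta)^{5/2}}\,d\theta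 ,$$ where for $b=1$ the term $\frac{b^2}{\sqrt{b^2-1}}\arcsin\sqrt{\frac{b^2-1}{b^2}}$ means its limit $1$ as $b\to1^+$. (Both $d\sigma$ and the integrand of the Hayward mass are integrable for all large $a$.) In contrast, if $b>1$, then $\lim_{a\to\infty}\mathfrak m_{\rm Hawking}(\Sigma_a)=-\infty$. -/

import Mathlib

open Real Set Filter Topology MeasureTheory Asymptotics

noncomputable section

namespace QuasiLocal

/-- A (pseudo-)Riemannian metric in a coordinate chart: the matrix of its components. -/
abbrev MetricField (n : ℕ) := (Fin n → ℝ) → Matrix (Fin n) (Fin n) ℝ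

/-- A vector field in a coordinate chart, given by its components. -/
abbrev VField (n : ℕ) := (Fin n → ℝ) → (Fin n → ℝ)

/-- The partial derivative of `f` in the `i`-th coordinate, at `x`. -/
def pd {n : ℕ} (i : Fin n) (f : (Fin n → ℝ) → ℝ) (x : Fin n → ℝ) : ℝ :=
  deriv (fun s : ℝ => f (Function.update x i s)) (x i)

/-- The value `g_x(v, w)`. -/
def ip {n : ℕ} (g : MetricField n) (x v w : Fin n → ℝ) : ℝ :=
  ∑ i, ∑ j, g x i j * v i * w j

/-- Christoffel symbols `Γ^k_{ij}` of the Levi-Civita connection. -/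
def christoffel {n : ℕ} (g : MetricField n) (k i j : Fin n) (x : Fin n → ℝ) : ℝ :=
  (1 / 2) * ∑ l, (g x)⁻¹ k l *
    (pd i (fun y => g y j l) x + pd j (fun y => g y i l) x - pd l (fun y => g y i j) x)

/-- Ricci curvature; the sign is such that round spheres have positive curvature. -/
def ricci {n : ℕ} (g : MetricField n) (i j : Fin n) (x : Fin n → ℝ) : ℝ :=
  ∑ k, (pd k (christoffel g k i j) x - pd j (christoffel g k i k) x
    + ∑ l, (christoffel g k k l x * christoffel g l i j x
          - christoffel g k j l x * christoffel g l i k x))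

/-- Scalar curvature. -/
def scalarCurvature {n : ℕ} (g : MetricField n) (x : Fin n → ℝ) : ℝ :=
  ∑ i, ∑ j, (g x)⁻¹ i j * ricci g i j x

/-- The covariant derivative `∇_v V` at `x`. -/
def covDeriv {n : ℕ} (g : MetricField n) (v : Fin n → ℝ) (V : VField n) (x : Fin n → ℝ) :
    Fin n → ℝ :=
  fun k => ∑ i, v i * pd i (fun y => V y k) x + ∑ i, ∑ j, christoffel g k i j x * v i * V x j

/-- The commutator `[V, W]`. -/
def lieBracket {n : ℕ} (V W : VField n) : VField n :=
  fun x k => ∑ i, (V x i * pd i (fun y => W y k) x - W x i * pd i (fun y => V y k) x)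

/-- The gradient of a function. -/
def grad {n : ℕ} (g : MetricField n) (u : (Fin n → ℝ) → ℝ) : VField n :=
  fun x i => ∑ j, (g x)⁻¹ i j * pd j u x

/-! ### Parametrized spacelike 2-surfaces in a spacetime

`X : (Fin 2 → ℝ) → (Fin 4 → ℝ)` is a parametrization of the surface, up to a set of area zero, by
the open set `U` of parameters. `lp` and `lm` are the outgoing and the ingoing null normal vector
field, given near the surface. -/

/-- The coordinate tangent vector `∂X/∂y^A`. -/
def tangentVec (X : (Fin 2 → ℝ) → (Fin 4 → ℝ)) (A : Fin 2) (y : Fin 2 → ℝ) : Fin 4 → ℝ :=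
  fun i => pd A (fun z => X z i) y

/-- The induced 2-metric `σ`. -/
def inducedMetric (g : MetricField 4) (X : (Fin 2 → ℝ) → (Fin 4 → ℝ)) : MetricField 2 :=
  fun y => Matrix.of fun A B => ip g (X y) (tangentVec X A y) (tangentVec X B y)

/-- The density `√(det σ)` of the area form. -/
def areaDensity (g : MetricField 4) (X : (Fin 2 → ℝ) → (Fin 4 → ℝ)) (y : Fin 2 → ℝ) : ℝ :=
  √(inducedMetric g X y).det

/-- The area `|Σ|`. -/
def area (g : MetricField 4) (X : (Fin 2 → ℝ) → (Fin 4 → ℝ)) (U : Set (Fin 2 → ℝ)) : ℝ :=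
  ∫ y in U, areaDensity g X y

/-- The second fundamental form `g(∇_A l, ∂_B)` of the surface in the normal direction `l`. -/
def nullForm (g : MetricField 4) (X : (Fin 2 → ℝ) → (Fin 4 → ℝ)) (l : VField 4)
    (A B : Fin 2) (y : Fin 2 → ℝ) : ℝ :=
  ip g (X y) (covDeriv g (tangentVec X A y) l (X y)) (tangentVec X B y)

/-- The expansion of the congruence generated by `l`, which is half of the `σ`-trace of the Lie
derivative of the metric along `l`. -/
def expansion (g : MetricField 4) (X : (Fin 2 → ℝ) → (Fin 4 → ℝ)) (l : VField 4)
    (y : Fin 2 → ℝ) : ℝ :=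
  ∑ A, ∑ B, (inducedMetric g X y)⁻¹ A B * nullForm g X l A B y

/-- The shear tensor of the congruence generated by `l`, in the normalization of Hayward: the trace
free part of the Lie derivative `(L_l g)_{AB} = g(∇_A l, ∂_B) + g(∇_B l, ∂_A)`. -/
def shear (g : MetricField 4) (X : (Fin 2 → ℝ) → (Fin 4 → ℝ)) (l : VField 4)
    (A B : Fin 2) (y : Fin 2 → ℝ) : ℝ :=
  nullForm g X l A B y + nullForm g X l B A y - expansion g X l y * inducedMetric g X y A B

/-- The contraction `σ^+_{AB} σ_-^{AB}` of the two shear tensors. -/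
def shearProduct (g : MetricField 4) (X : (Fin 2 → ℝ) → (Fin 4 → ℝ)) (lp lm : VField 4)
    (y : Fin 2 → ℝ) : ℝ :=
  ∑ A, ∑ B, ∑ C, ∑ D, (inducedMetric g X y)⁻¹ A C * (inducedMetric g X y)⁻¹ B D *
    shear g X lp A B y * shear g X lm C D y

/-- The anholonomicity `ω`, the projection of `[l_+, l_-]` onto the surface, with its index
lowered: `ω_A = g([l_+, l_-], ∂_A)`. -/
def anholonomicity (g : MetricField 4) (X : (Fin 2 → ℝ) → (Fin 4 → ℝ)) (lp lm : VField 4)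
    (A : Fin 2) (y : Fin 2 → ℝ) : ℝ :=
  ip g (X y) (lieBracket lp lm (X y)) (tangentVec X A y)

/-- `ω^k ω_k`. -/
def anholonomicitySq (g : MetricField 4) (X : (Fin 2 → ℝ) → (Fin 4 → ℝ)) (lp lm : VField 4)
    (y : Fin 2 → ℝ) : ℝ :=
  ∑ A, ∑ B, (inducedMetric g X y)⁻¹ A B *
    anholonomicity g X lp lm A y * anholonomicity g X lp lm B y

/-- The integrand `R_σ + θ_+ θ_-` of the Hawking mass. -/
def hawkingIntegrand (g : MetricField 4) (X : (Fin 2 → ℝ) → (Fin 4 → ℝ)) (lp lm : VField 4)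
    (y : Fin 2 → ℝ) : ℝ :=
  scalarCurvature (inducedMetric g X) y + expansion g X lp y * expansion g X lm y

/-- The integrand `R_σ + θ_+ θ_- - σ^+_{ij} σ_-^{ij} / 2 - 2 ω^k ω_k` of the Hayward mass. -/
def haywardIntegrand (g : MetricField 4) (X : (Fin 2 → ℝ) → (Fin 4 → ℝ)) (lp lm : VField 4)
    (y : Fin 2 → ℝ) : ℝ :=
  scalarCurvature (inducedMetric g X) y + expansion g X lp y * expansion g X lm y
    - (1 / 2) * shearProduct g X lp lm y - 2 * anholonomicitySq g X lp lm y

/-- The Hawking mass of a surface. -/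
def hawkingMass (g : MetricField 4) (X : (Fin 2 → ℝ) → (Fin 4 → ℝ)) (U : Set (Fin 2 → ℝ))
    (lp lm : VField 4) : ℝ :=
  1 / (8 * π) * √(area g X U / (16 * π)) *
    ∫ y in U, hawkingIntegrand g X lp lm y * areaDensity g X y

/-- The Hayward mass of a surface. -/
def haywardMass (g : MetricField 4) (X : (Fin 2 → ℝ) → (Fin 4 → ℝ)) (U : Set (Fin 2 → ℝ))
    (lp lm : VField 4) : ℝ :=
  1 / (8 * π) * √(area g X U / (16 * π)) *
    ∫ y in U, haywardIntegrand g X lp lm y * areaDensity g X y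

/-! ### Static spherically symmetric spacetimes and ellipsoids

The coordinates are `x 0 = t`, `x 1 = R`, `x 2 = Θ`, `x 3 = φ`. -/

/-- The metric `-e^γ(R) dt² + e^λ(R) dR² + R² dΘ² + R² sin² Θ dφ²`. -/
def staticMetric (γ lam : ℝ → ℝ) : MetricField 4 :=
  fun x => Matrix.diagonal
    ![-exp (γ (x 1)), exp (lam (x 1)), x 1 ^ 2, x 1 ^ 2 * sin (x 2) ^ 2]

/-- The Cartesian coordinates `(x¹, x², x³)` that belong to the spherical ones. -/
def cartesian (x : Fin 4 → ℝ) : Fin 3 → ℝ :=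
  ![x 1 * sin (x 2) * cos (x 3), x 1 * sin (x 2) * sin (x 3), x 1 * cos (x 2)]

/-- The function `√((x¹)² + (x²)² + (x³)²/b²)`, whose level set of value `a` is the ellipsoid
`Σ_a` (in each time slice). -/
def ellipsoidalRadius (b : ℝ) (x : Fin 4 → ℝ) : ℝ :=
  √(cartesian x 0 ^ 2 + cartesian x 1 ^ 2 + cartesian x 2 ^ 2 / b ^ 2)

/-- The parametrization `(θ, φ) ↦ (a sin θ cos φ, a sin θ sin φ, a b cos θ)` of `Σ_a` in the time
slice `t = t₀`, in the coordinates `(t, R, Θ, φ)`; see `cartesian_ellipsoid`. -/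
def ellipsoid (t₀ b a : ℝ) (y : Fin 2 → ℝ) : Fin 4 → ℝ :=
  ![t₀,
    a * √(sin (y 0) ^ 2 + b ^ 2 * cos (y 0) ^ 2),
    arccos (b * cos (y 0) / √(sin (y 0) ^ 2 + b ^ 2 * cos (y 0) ^ 2)),
    y 1]

/-- The range `0 < θ < π`, `0 < φ < 2π` of the parameters. It covers the ellipsoid but for one
meridian. -/
def angles : Set (Fin 2 → ℝ) := {y | y 0 ∈ Ioo 0 π ∧ y 1 ∈ Ioo 0 (2 * π)}

theorem cartesian_ellipsoid (t₀ b a : ℝ) (y : Fin 2 → ℝ) (hb : 0 < b) (hy : y 0 ∈ Ioo 0 π) :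
    cartesian (ellipsoid t₀ b a y) =
      ![a * sin (y 0) * cos (y 1), a * sin (y 0) * sin (y 1), a * b * cos (y 0)] := by
  have hs : 0 < sin (y 0) := sin_pos_of_pos_of_lt_pi hy.1 hy.2
  have hD : 0 < sin (y 0) ^ 2 + b ^ 2 * cos (y 0) ^ 2 := by positivity
  set w := √(sin (y 0) ^ 2 + b ^ 2 * cos (y 0) ^ 2) with hw
  have hw0 : 0 < w := sqrt_pos.2 hD
  have hw2 : w ^ 2 = sin (y 0) ^ 2 + b ^ 2 * cos (y 0) ^ 2 := sq_sqrt hD.le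
  have hle : (b * cos (y 0) / w) ^ 2 ≤ 1 := by
    rw [div_pow, div_le_one (by positivity), hw2]
    nlinarith [sq_nonneg (sin (y 0))]
  have hc := abs_le.1 ((sq_le_one_iff_abs_le_one _).1 hle)
  have h1 : cos (arccos (b * cos (y 0) / w)) = b * cos (y 0) / w := cos_arccos hc.1 hc.2
  have h2 : sin (arccos (b * cos (y 0) / w)) = sin (y 0) / w := by
    rw [sin_arccos]
    have : 1 - (b * cos (y 0) / w) ^ 2 = (sin (y 0) / w) ^ 2 := by
      field_simp
      rw [hw2]
      ring
    rw [this, sqrt_sq (by positivity)]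
  ext i
  fin_cases i
  · simp only [cartesian, ellipsoid, ← hw, h2, Matrix.cons_val, Fin.isValue, Fin.zero_eta]
    field_simp
  · simp only [cartesian, ellipsoid, ← hw, h2, Matrix.cons_val, Fin.isValue, Fin.mk_one]
    field_simp
  · simp only [cartesian, ellipsoid, ← hw, h1, Matrix.cons_val, Fin.isValue, Fin.reduceFinMk]
    field_simp

/-- `e_0 = e^(-γ/2) ∂_t`, the future directed unit normal of the time slices. -/
def timeNormal (γ : ℝ → ℝ) : VField 4 := fun x => ![exp (-γ (x 1) / 2), 0, 0, 0]

/-- `e_1`, the outward unit normal of the ellipsoids `Σ_a` in the time slices. -/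
def ellipsoidNormal (γ lam : ℝ → ℝ) (b : ℝ) : VField 4 :=
  fun x =>
    (1 / √(ip (staticMetric γ lam) x (grad (staticMetric γ lam) (ellipsoidalRadius b) x)
      (grad (staticMetric γ lam) (ellipsoidalRadius b) x))) •
    grad (staticMetric γ lam) (ellipsoidalRadius b) x

/-- The outgoing null normal `l_+ = (e_0 + e_1)/√2`. -/
def outgoingNormal (γ lam : ℝ → ℝ) (b : ℝ) : VField 4 :=
  fun x => (1 / √2) • (timeNormal γ x + ellipsoidNormal γ lam b x)

/-- The ingoing null normal `l_- = (e_0 - e_1)/√2`. -/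
def ingoingNormal (γ lam : ℝ → ℝ) (b : ℝ) : VField 4 :=
  fun x => (1 / √2) • (timeNormal γ x - ellipsoidNormal γ lam b x)

/-- The Hawking mass of `Σ_a` in the time slice `t = t₀`. -/
def ellipsoidHawkingMass (γ lam : ℝ → ℝ) (t₀ b a : ℝ) : ℝ :=
  hawkingMass (staticMetric γ lam) (ellipsoid t₀ b a) angles
    (outgoingNormal γ lam b) (ingoingNormal γ lam b)

/-- The Hayward mass of `Σ_a` in the time slice `t = t₀`. -/
def ellipsoidHaywardMass (γ lam : ℝ → ℝ) (t₀ b a : ℝ) : ℝ :=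
  haywardMass (staticMetric γ lam) (ellipsoid t₀ b a) angles
    (outgoingNormal γ lam b) (ingoingNormal γ lam b)

/-- `b²/√(b²-1) · arcsin √((b²-1)/b²)` for `b > 1`; at `b = 1` this means its limit as `b → 1⁺`,
which is `1`. -/
def arcsinTerm (b : ℝ) : ℝ :=
  if b = 1 then 1 else b ^ 2 / √(b ^ 2 - 1) * arcsin √((b ^ 2 - 1) / b ^ 2)

end QuasiLocal

end

/-!
In a static spacetime a time slice is totally geodesic, so for a surface in it with principal
curvatures `κ₁`, `κ₂` the null expansions have the product `-(κ₁ + κ₂)² / 2`, the shears have the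
product `-(κ₁ - κ₂)²`, and the anholonomicity vanishes. Hence the Hayward integrand is
`R_σ - 2 κ₁ κ₂`. By the Gauss equation this is twice the sectional curvature of the slice on the
tangent planes of the surface, whereas the Hawking integrand is smaller by `(κ₁ - κ₂)² / 2`
(`integrand_ellipsoid`). The Gauss equation is not used in general: the scalar curvature of a
rotationally symmetric surface (`scalarCurvature_rotational`) and its second fundamental form
(`nullForm_ellipsoid`) are computed explicitly, and compared in `scalarCurvature_ellipsoid`.

The sectional curvatures of the slice are `(1 - e^{-λ}) / R² ~ 2m / R³` and
`λ' e^{-λ} / (2R) ~ -m / R³`. On `Σ_a` they are of order `a⁻³`, the area form is of order `a²` and the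
factor in front of the integral is of order `a`, so the Hayward mass converges. The term
`(κ₁ - κ₂)² / 2` has an integral that is invariant under scaling in flat space and positive for
`b > 1` (`integral_shearProfile_pos`), so the Hawking mass tends to `-∞` linearly in `a`.

For the limits, each integrand is written as a power of `a` times a continuous function of `θ` and of
quantities like `R (e^λ - 1)` that converge as `R → ∞`; since `R ≥ a` on `Σ_a`, dominated convergence
applies (`tendsto_setIntegral_angles`). The area of the limiting spheroid is
`integral_sin_mul_sqrt`.
-/

noncomputable section

namespace QuasiLocal

/-! ### Partial derivatives -/

theorem pd_congr {n : ℕ} {i : Fin n} {f g : (Fin n → ℝ) → ℝ} {x : Fin n → ℝ}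
    (h : f =ᶠ[𝓝 x] g) : pd i f x = pd i g x := by
  have hc : Tendsto (fun s : ℝ => Function.update x i s) (𝓝 (x i)) (𝓝 x) := by
    have : Continuous fun s : ℝ => Function.update x i s := continuous_const.update i continuous_id
    simpa using this.tendsto (x i)
  have hl : (fun s => f (Function.update x i s)) =ᶠ[𝓝 (x i)] fun s => g (Function.update x i s) :=
    hc.eventually h
  exact hl.deriv_eq

theorem pd_eq_of_hasDerivAt {n : ℕ} {i : Fin n} {f : (Fin n → ℝ) → ℝ} {x : Fin n → ℝ} {f' : ℝ}
    (h : HasDerivAt (fun s => f (Function.update x i s)) f' (x i)) : pd i f x = f' :=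
  h.deriv

theorem pd_const {n : ℕ} (i : Fin n) (c : ℝ) (x : Fin n → ℝ) : pd i (fun _ => c) x = 0 := by
  simp [pd]

/-- A function of a single coordinate. -/
theorem pd_comp_apply {n : ℕ} (i j : Fin n) (f : ℝ → ℝ) (x : Fin n → ℝ) :
    pd i (fun z => f (z j)) x = if i = j then deriv f (x j) else 0 := by
  split_ifs with h
  · subst h; simp [pd]
  · simp [pd, Function.update_of_ne (Ne.symm h)]

theorem inv_diagonal_of_ne_zero {n : ℕ} (d : Fin n → ℝ) (hd : ∀ i, d i ≠ 0) :
    (Matrix.diagonal d)⁻¹ = Matrix.diagonal fun i => (d i)⁻¹ := by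
  refine Matrix.inv_eq_left_inv ?_
  rw [Matrix.diagonal_mul_diagonal, ← Matrix.diagonal_one]
  congr 1
  ext i
  exact inv_mul_cancel₀ (hd i)

/-! ### Curvature of rotationally symmetric surfaces -/

/-- Scalar curvature of the metric `E(θ) dθ² + G(θ) dφ²`. The second derivative of `E` cancels, so
that `E` only needs to be differentiable once. -/
theorem scalarCurvature_rotational {g : MetricField 2} {E G E₁ G₁ : ℝ → ℝ} {G₂ : ℝ} {I : Set ℝ}
    (hI : IsOpen I) (hg : ∀ z, z 0 ∈ I → g z = Matrix.diagonal ![E (z 0), G (z 0)])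
    (hE0 : ∀ t ∈ I, E t ≠ 0) (hG0 : ∀ t ∈ I, G t ≠ 0)
    (hE : ∀ t ∈ I, HasDerivAt E (E₁ t) t) (hG : ∀ t ∈ I, HasDerivAt G (G₁ t) t)
    {y : Fin 2 → ℝ} (hy : y 0 ∈ I) (hG₁ : HasDerivAt G₁ G₂ (y 0)) :
    scalarCurvature g y = -G₂ / (E (y 0) * G (y 0)) +
      G₁ (y 0) * E₁ (y 0) / (2 * E (y 0) ^ 2 * G (y 0)) +
      G₁ (y 0) ^ 2 / (2 * E (y 0) * G (y 0) ^ 2) := by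
  have hopen : IsOpen {z : Fin 2 → ℝ | z 0 ∈ I} := hI.preimage (continuous_apply 0)
  have hinv : ∀ z : Fin 2 → ℝ, z 0 ∈ I →
      (g z)⁻¹ = Matrix.diagonal ![(E (z 0))⁻¹, (G (z 0))⁻¹] := by
    intro z hz
    rw [hg z hz, inv_diagonal_of_ne_zero]
    · congr 1; ext i; fin_cases i <;> rfl
    · intro i; fin_cases i
      · exact hE0 _ hz
      · exact hG0 _ hz
  have hpd : ∀ z : Fin 2 → ℝ, z 0 ∈ I → ∀ i j k, pd i (fun x => g x j k) z =
      if i = 0 then (Matrix.diagonal ![E₁ (z 0), G₁ (z 0)]) j k else 0 := by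
    intro z hz i j k
    have h1 : (fun x => g x j k) =ᶠ[𝓝 z]
        fun x => (Matrix.diagonal ![E (x 0), G (x 0)]) j k := by
      filter_upwards [hopen.mem_nhds hz] with x hx
      rw [hg x hx]
    rw [pd_congr h1, pd_comp_apply i 0 (fun t => (Matrix.diagonal ![E t, G t]) j k)]
    refine if_congr Iff.rfl ?_ rfl
    fin_cases j <;> fin_cases k <;> simp [(hE _ hz).deriv, (hG _ hz).deriv]
  have h000 : ∀ z : Fin 2 → ℝ, z 0 ∈ I → christoffel g 0 0 0 z = E₁ (z 0) / (2 * E (z 0)) := by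
    intro z hz
    simp [christoffel, Fin.sum_univ_two, hinv z hz, hpd z hz]; ring
  have h011 : ∀ z : Fin 2 → ℝ, z 0 ∈ I → christoffel g 0 1 1 z = -G₁ (z 0) / (2 * E (z 0)) := by
    intro z hz
    simp [christoffel, hinv z hz, hpd z hz]; ring
  have h101 : ∀ z : Fin 2 → ℝ, z 0 ∈ I → christoffel g 1 0 1 z = G₁ (z 0) / (2 * G (z 0)) := by
    intro z hz
    simp [christoffel, Fin.sum_univ_two, hinv z hz, hpd z hz]; ring
  have h110 : ∀ z : Fin 2 → ℝ, z 0 ∈ I → christoffel g 1 1 0 z = G₁ (z 0) / (2 * G (z 0)) := by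
    intro z hz
    simp [christoffel, Fin.sum_univ_two, hinv z hz, hpd z hz]; ring
  have h001 : ∀ z : Fin 2 → ℝ, z 0 ∈ I → christoffel g 0 0 1 z = 0 := by
    intro z hz
    simp [christoffel, Fin.sum_univ_two, hinv z hz, hpd z hz]
  have h010 : ∀ z : Fin 2 → ℝ, z 0 ∈ I → christoffel g 0 1 0 z = 0 := by
    intro z hz
    simp [christoffel, Fin.sum_univ_two, hinv z hz, hpd z hz]
  have h100 : ∀ z : Fin 2 → ℝ, z 0 ∈ I → christoffel g 1 0 0 z = 0 := by
    intro z hz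
    simp [christoffel, Fin.sum_univ_two, hinv z hz, hpd z hz]
  have h111 : ∀ z : Fin 2 → ℝ, z 0 ∈ I → christoffel g 1 1 1 z = 0 := by
    intro z hz
    simp [christoffel, hinv z hz, hpd z hz]
  have key : ∀ {k i j : Fin 2} {f : ℝ → ℝ} (l : Fin 2),
      (∀ z : Fin 2 → ℝ, z 0 ∈ I → christoffel g k i j z = f (z 0)) →
      pd l (christoffel g k i j) y = if l = 0 then deriv f (y 0) else 0 := by
    intro k i j f l h
    rw [← pd_comp_apply]
    refine pd_congr ?_
    filter_upwards [hopen.mem_nhds hy] with z hz using h z hz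
  have hE0' := hE0 _ hy
  have hG0' := hG0 _ hy
  have d011 : deriv (fun t => -G₁ t / (2 * E t)) (y 0) =
      (-G₂ * (2 * E (y 0)) - -G₁ (y 0) * (2 * E₁ (y 0))) / (2 * E (y 0)) ^ 2 :=
    (hG₁.neg.div ((hE _ hy).const_mul 2) (mul_ne_zero two_ne_zero hE0')).deriv
  have d101 : deriv (fun t => G₁ t / (2 * G t)) (y 0) =
      (G₂ * (2 * G (y 0)) - G₁ (y 0) * (2 * G₁ (y 0))) / (2 * G (y 0)) ^ 2 :=
    (hG₁.div ((hG _ hy).const_mul 2) (mul_ne_zero two_ne_zero hG0')).deriv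
  have p011 := key (f := fun t => -G₁ t / (2 * E t)) 0 h011
  have p101 := key (f := fun t => G₁ t / (2 * G t)) 0 h101
  have p1 : ∀ {k i j : Fin 2} {f : ℝ → ℝ},
      (∀ z : Fin 2 → ℝ, z 0 ∈ I → christoffel g k i j z = f (z 0)) →
      pd 1 (christoffel g k i j) y = 0 := fun h => by rw [key 1 h]; simp
  have q001 := key (f := fun t => (0 : ℝ)) 0 h001
  rw [d011] at p011
  rw [d101] at p101
  simp only [if_true] at p011 p101
  -- The terms `∂_θ Γ^θ_θθ`, the only ones with a second derivative of `E`, cancel in `ricci 0 0`.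
  have r00 : ricci g 0 0 y = -(G₂ * (2 * G (y 0)) - G₁ (y 0) * (2 * G₁ (y 0))) / (2 * G (y 0)) ^ 2
      + E₁ (y 0) / (2 * E (y 0)) * (G₁ (y 0) / (2 * G (y 0))) - (G₁ (y 0) / (2 * G (y 0))) ^ 2 := by
    simp only [ricci, Fin.sum_univ_two, h000 y hy, h101 y hy, h110 y hy, h001 y hy,
      h100 y hy, h111 y hy, p101, p1 (f := fun _ => (0 : ℝ)) h100]
    ring
  have r11 : ricci g 1 1 y =
      (-G₂ * (2 * E (y 0)) - -G₁ (y 0) * (2 * E₁ (y 0))) / (2 * E (y 0)) ^ 2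
      + E₁ (y 0) / (2 * E (y 0)) * (-G₁ (y 0) / (2 * E (y 0)))
      - -G₁ (y 0) / (2 * E (y 0)) * (G₁ (y 0) / (2 * G (y 0))) := by
    simp only [ricci, Fin.sum_univ_two, h000 y hy, h011 y hy, h110 y hy, h001 y hy,
      h010 y hy, h111 y hy, p011, p1 (f := fun _ => (0 : ℝ)) h010,
      p1 (f := fun _ => (0 : ℝ)) h111]
    ring
  simp only [scalarCurvature, Fin.sum_univ_two, hinv y hy, r00, r11]
  simp
  field_simp
  ring

/-! ### The static metric and its Levi-Civita connection -/

theorem staticMetric_inv (γ lam : ℝ → ℝ) {x : Fin 4 → ℝ} (hR : 0 < x 1) (hS : 0 < sin (x 2)) :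
    (staticMetric γ lam x)⁻¹ = Matrix.diagonal ![-(exp (γ (x 1)))⁻¹, (exp (lam (x 1)))⁻¹,
      (x 1 ^ 2)⁻¹, (x 1 ^ 2 * sin (x 2) ^ 2)⁻¹] := by
  rw [staticMetric, inv_diagonal_of_ne_zero]
  · congr 1; ext i; fin_cases i <;> simp [inv_neg]
  · intro i; fin_cases i <;> simp [hR.ne', hS.ne']

theorem pd_staticMetric {γ lam : ℝ → ℝ} {x : Fin 4 → ℝ} {γ' P : ℝ}
    (hγ : HasDerivAt γ γ' (x 1)) (hL : HasDerivAt (fun r => exp (lam r)) P (x 1))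
    (i j k : Fin 4) :
    pd i (fun z => staticMetric γ lam z j k) x =
      (if i = 1 then Matrix.diagonal
          ![-(exp (γ (x 1)) * γ'), P, 2 * x 1, 2 * x 1 * sin (x 2) ^ 2] j k
        else if i = 2 then Matrix.diagonal
          ![0, 0, 0, x 1 ^ 2 * (2 * sin (x 2) * cos (x 2))] j k
        else 0) := by
  have hs : HasDerivAt (fun t => sin t ^ 2) (2 * sin (x 2) * cos (x 2)) (x 2) := by
    simpa using (hasDerivAt_sin (x 2)).fun_pow 2
  have hsq : HasDerivAt (fun r : ℝ => r ^ 2) (2 * x 1) (x 1) := by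
    simpa using hasDerivAt_pow 2 (x 1)
  by_cases hjk : j = k
  · subst hjk
    refine pd_eq_of_hasDerivAt ?_
    fin_cases i <;> fin_cases j <;>
      simp only [staticMetric, Fin.zero_eta, Fin.mk_one, Fin.reduceFinMk, Fin.isValue,
        Matrix.diagonal_apply_eq, Matrix.cons_val, ne_eq, Fin.reduceEq, not_false_eq_true,
        Function.update_of_ne, Function.update_self, reduceIte] <;>
      first
        | exact hasDerivAt_const _ _
        | exact hγ.exp.neg
        | exact hL
        | exact hsq
        | exact hsq.mul_const _
        | exact hs.const_mul _
  · simp [staticMetric, Matrix.diagonal_apply_ne _ hjk, pd_const]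

/-- `g(∇_v V, w)` for `v`, `w` tangent to the time slices and `V` without `φ`-component: the
derivatives of the components of `V`, and the first derivatives of the metric. -/
theorem ip_covDeriv_staticMetric {γ lam : ℝ → ℝ} {x : Fin 4 → ℝ} {γ' P : ℝ}
    (hR : 0 < x 1) (hS : 0 < sin (x 2))
    (hγ : HasDerivAt γ γ' (x 1)) (hL : HasDerivAt (fun r => exp (lam r)) P (x 1))
    (v₁ v₂ v₃ w₁ w₂ w₃ : ℝ) (V : VField 4) (hV : V x 3 = 0) :
    ip (staticMetric γ lam) x (covDeriv (staticMetric γ lam) ![0, v₁, v₂, v₃] V x)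
        ![0, w₁, w₂, w₃] =
      exp (lam (x 1)) * w₁ * (v₁ * pd 1 (fun z => V z 1) x + v₂ * pd 2 (fun z => V z 1) x
        + v₃ * pd 3 (fun z => V z 1) x) +
      x 1 ^ 2 * w₂ * (v₁ * pd 1 (fun z => V z 2) x + v₂ * pd 2 (fun z => V z 2) x
        + v₃ * pd 3 (fun z => V z 2) x) +
      x 1 ^ 2 * sin (x 2) ^ 2 * w₃ *
        (v₁ * pd 1 (fun z => V z 3) x + v₂ * pd 2 (fun z => V z 3) x
        + v₃ * pd 3 (fun z => V z 3) x) +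
      V x 1 * (P * v₁ * w₁ / 2 + x 1 * v₂ * w₂ + x 1 * sin (x 2) ^ 2 * v₃ * w₃) +
      V x 2 * (x 1 ^ 2 * sin (x 2) * cos (x 2) * v₃ * w₃ + x 1 * (v₁ * w₂ - w₁ * v₂)) := by
  have hR' := hR.ne'
  have hS' := hS.ne'
  have hE := (exp_pos (lam (x 1))).ne'
  simp [ip, covDeriv, christoffel, Fin.sum_univ_four, staticMetric_inv γ lam hR hS,
    pd_staticMetric hγ hL, hV]
  simp [staticMetric]
  field_simp
  ring

/-! ### The unit normal of the ellipsoids -/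

/-- The function `Q` of the polar angle with `R² Q = (x¹)² + (x²)² + (x³)²/b²`. -/
def polarForm (b Θ : ℝ) : ℝ := sin Θ ^ 2 + cos Θ ^ 2 / b ^ 2

/-- Half the derivative of `polarForm`. -/
def polarSlope (b Θ : ℝ) : ℝ := (1 - 1 / b ^ 2) * (sin Θ * cos Θ)

/-- The squared length of the normal vector `Q e^{-λ} ∂_R + (Q'/2) R⁻¹ ∂_Θ` of the ellipsoids, as a
function of `L = e^λ` and `Θ`. -/
def normalLengthSq (b L Θ : ℝ) : ℝ := polarForm b Θ ^ 2 / L + polarSlope b Θ ^ 2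

theorem polarForm_pos {b Θ : ℝ} (hS : 0 < sin Θ) : 0 < polarForm b Θ := by
  unfold polarForm; positivity

theorem normalLengthSq_pos {b L Θ : ℝ} (hL : 0 < L) (hS : 0 < sin Θ) :
    0 < normalLengthSq b L Θ := by
  have := polarForm_pos (b := b) hS
  unfold normalLengthSq; positivity

theorem hasDerivAt_polarForm (b Θ : ℝ) :
    HasDerivAt (polarForm b) (2 * polarSlope b Θ) Θ := by
  have h := ((hasDerivAt_sin Θ).fun_pow 2).add (((hasDerivAt_cos Θ).fun_pow 2).div_const (b ^ 2))
  refine h.congr_deriv ?_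
  simp only [polarSlope]
  ring

theorem hasDerivAt_polarSlope (b Θ : ℝ) :
    HasDerivAt (polarSlope b) ((1 - 1 / b ^ 2) * (cos Θ ^ 2 - sin Θ ^ 2)) Θ := by
  have h := ((hasDerivAt_sin Θ).fun_mul (hasDerivAt_cos Θ)).const_mul (1 - 1 / b ^ 2)
  refine h.congr_deriv ?_
  ring

theorem isOpen_exterior (R₀ : ℝ) : IsOpen {x : Fin 4 → ℝ | R₀ < x 1 ∧ 0 < sin (x 2)} :=
  (isOpen_lt continuous_const (continuous_apply 1)).inter
    (isOpen_lt continuous_const (continuous_sin.comp (continuous_apply 2)))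

theorem ellipsoidalRadius_eq {b : ℝ} {x : Fin 4 → ℝ} (hR : 0 < x 1) :
    ellipsoidalRadius b x = x 1 * √(polarForm b (x 2)) := by
  have : cartesian x 0 ^ 2 + cartesian x 1 ^ 2 + cartesian x 2 ^ 2 / b ^ 2 =
      x 1 ^ 2 * polarForm b (x 2) := by
    simp only [cartesian, polarForm, Matrix.cons_val]
    linear_combination x 1 ^ 2 * sin (x 2) ^ 2 * sin_sq_add_cos_sq (x 3)
  rw [ellipsoidalRadius, this, sqrt_mul (by positivity), sqrt_sq hR.le]

theorem grad_ellipsoidalRadius (γ lam : ℝ → ℝ) (b : ℝ) {x : Fin 4 → ℝ} (hR : 0 < x 1)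
    (hS : 0 < sin (x 2)) :
    grad (staticMetric γ lam) (ellipsoidalRadius b) x =
      ![0, √(polarForm b (x 2)) / exp (lam (x 1)),
        polarSlope b (x 2) / √(polarForm b (x 2)) / x 1, 0] := by
  have hQ := polarForm_pos (b := b) hS
  have hev : ellipsoidalRadius b =ᶠ[𝓝 x] fun z => z 1 * √(polarForm b (z 2)) := by
    filter_upwards [(isOpen_exterior 0).mem_nhds ⟨hR, hS⟩] with z hz using ellipsoidalRadius_eq hz.1
  have h0 : pd 0 (ellipsoidalRadius b) x = 0 := by
    rw [pd_congr hev]; simp [pd]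
  have h3 : pd 3 (ellipsoidalRadius b) x = 0 := by
    rw [pd_congr hev]; simp [pd]
  have h1 : pd 1 (ellipsoidalRadius b) x = √(polarForm b (x 2)) := by
    rw [pd_congr hev]
    refine pd_eq_of_hasDerivAt ?_
    simpa using (hasDerivAt_id (x 1)).mul_const (√(polarForm b (x 2)))
  have h2 : pd 2 (ellipsoidalRadius b) x =
      x 1 * (2 * polarSlope b (x 2) / (2 * √(polarForm b (x 2)))) := by
    rw [pd_congr hev]
    refine pd_eq_of_hasDerivAt ?_
    simpa using ((hasDerivAt_polarForm b (x 2)).sqrt hQ.ne').const_mul (x 1)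
  have hq := (sqrt_pos.2 hQ).ne'
  ext i
  fin_cases i <;> simp [grad, Fin.sum_univ_four, staticMetric_inv γ lam hR hS, h0, h1, h2, h3]
  · field_simp
  · field_simp

/-- `e_1`, written as the normalization of `Q e^{-λ} ∂_R + (Q'/2) R⁻¹ ∂_Θ`, which has no square
roots. -/
theorem ellipsoidNormal_eq (γ lam : ℝ → ℝ) (b : ℝ) {x : Fin 4 → ℝ} (hR : 0 < x 1)
    (hS : 0 < sin (x 2)) :
    ellipsoidNormal γ lam b x = (1 / √(normalLengthSq b (exp (lam (x 1))) (x 2))) •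
      ![0, polarForm b (x 2) / exp (lam (x 1)), polarSlope b (x 2) / x 1, 0] := by
  have hQ := polarForm_pos (b := b) hS
  have hN := normalLengthSq_pos (b := b) (exp_pos (lam (x 1))) hS
  have hq := sqrt_pos.2 hQ
  have hq2 := sq_sqrt hQ.le
  have hlen : √(ip (staticMetric γ lam) x (grad (staticMetric γ lam) (ellipsoidalRadius b) x)
      (grad (staticMetric γ lam) (ellipsoidalRadius b) x)) =
      √(normalLengthSq b (exp (lam (x 1))) (x 2)) / √(polarForm b (x 2)) := by
    rw [← sqrt_div hN.le]
    congr 1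
    rw [grad_ellipsoidalRadius γ lam b hR hS]
    simp [ip, Fin.sum_univ_four, staticMetric, normalLengthSq]
    field_simp
    have hq4 : √(polarForm b (x 2)) ^ 4 = polarForm b (x 2) ^ 2 := by
      linear_combination (√(polarForm b (x 2)) ^ 2 + polarForm b (x 2)) * hq2
    rw [hq4, hq2]
    ring
  have hn := sqrt_pos.2 hN
  rw [ellipsoidNormal, hlen, grad_ellipsoidalRadius γ lam b hR hS]
  ext i
  fin_cases i <;> simp only [Pi.smul_apply, smul_eq_mul, Matrix.cons_val, Fin.zero_eta, Fin.mk_one,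
    Fin.reduceFinMk, Fin.isValue, mul_zero]
  · field_simp
    simp only [hq2]
  · field_simp

/-- Both null normals are of this form, with `ε = 1` for the outgoing and `ε = -1` for the ingoing
one. -/
def nullNormal (γ lam : ℝ → ℝ) (b ε : ℝ) : VField 4 :=
  fun x => (1 / √2) • (timeNormal γ x + ε • ellipsoidNormal γ lam b x)

theorem outgoingNormal_eq (γ lam : ℝ → ℝ) (b : ℝ) :
    outgoingNormal γ lam b = nullNormal γ lam b 1 := by
  funext x
  simp [outgoingNormal, nullNormal]

theorem ingoingNormal_eq (γ lam : ℝ → ℝ) (b : ℝ) :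
    ingoingNormal γ lam b = nullNormal γ lam b (-1) := by
  funext x
  simp [ingoingNormal, nullNormal, sub_eq_add_neg]

theorem nullNormal_eq (γ lam : ℝ → ℝ) (b ε : ℝ) {x : Fin 4 → ℝ} (hR : 0 < x 1)
    (hS : 0 < sin (x 2)) :
    nullNormal γ lam b ε x = ![1 / √2 * exp (-γ (x 1) / 2),
      ε / √2 * (1 / √(normalLengthSq b (exp (lam (x 1))) (x 2)) *
        (polarForm b (x 2) / exp (lam (x 1)))),
      ε / √2 * (1 / √(normalLengthSq b (exp (lam (x 1))) (x 2)) * (polarSlope b (x 2) / x 1)),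
      0] := by
  ext i
  fin_cases i <;> simp [nullNormal, ellipsoidNormal_eq γ lam b hR hS, timeNormal] <;> ring

/-- The second fundamental form `g(∇_v l, w)` of the ellipsoids for a null normal `l`, at
`v = v₁ ∂_R + v₂ ∂_Θ + v₃ ∂_φ` and `w = w₁ ∂_R + w₂ ∂_Θ + w₃ ∂_φ`, provided that `w` is tangent to the
ellipsoid. The derivative of the length of the normal vector drops out. -/
theorem ip_covDeriv_nullNormal {γ lam : ℝ → ℝ} {x : Fin 4 → ℝ} {γ' P : ℝ} (b ε : ℝ)
    (hR : 0 < x 1) (hS : 0 < sin (x 2))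
    (hγ : HasDerivAt γ γ' (x 1)) (hL : HasDerivAt (fun r => exp (lam r)) P (x 1))
    (v₁ v₂ v₃ w₁ w₂ w₃ : ℝ)
    (hw : w₁ * polarForm b (x 2) + x 1 * w₂ * polarSlope b (x 2) = 0) :
    ip (staticMetric γ lam) x
        (covDeriv (staticMetric γ lam) ![0, v₁, v₂, v₃] (nullNormal γ lam b ε) x)
        ![0, w₁, w₂, w₃] =
      ε / √2 / √(normalLengthSq b (exp (lam (x 1))) (x 2)) *
      (-(polarForm b (x 2) * P / (2 * exp (lam (x 1)))) * v₁ * w₁ +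
        polarSlope b (x 2) * v₂ * w₁ +
        x 1 * v₂ * w₂ * ((1 - 1 / b ^ 2) * (cos (x 2) ^ 2 - sin (x 2) ^ 2) +
          polarForm b (x 2) / exp (lam (x 1))) +
        x 1 * sin (x 2) * (sin (x 2) * (polarForm b (x 2) / exp (lam (x 1))) +
          cos (x 2) * polarSlope b (x 2)) * v₃ * w₃) := by
  have hN := normalLengthSq_pos (b := b) (exp_pos (lam (x 1))) hS
  have hn := (sqrt_pos.2 hN).ne'
  have hR' := hR.ne'
  have hE := (exp_pos (lam (x 1))).ne'
  have hev := fun k : Fin 4 => (show (fun z => nullNormal γ lam b ε z k) =ᶠ[𝓝 x] _ by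
    filter_upwards [(isOpen_exterior 0).mem_nhds ⟨hR, hS⟩] with z hz using
      congrFun (nullNormal_eq γ lam b ε hz.1 hz.2) k)
  -- The values of the derivatives of the normalizing factor do not matter, since they multiply the
  -- inner product of `w` with the normal.
  obtain ⟨f₁, hf₁⟩ : ∃ f', HasDerivAt
      (fun r => 1 / √(normalLengthSq b (exp (lam r)) (x 2))) f' (x 1) := by
    have := (((hasDerivAt_const (x 1) (polarForm b (x 2) ^ 2)).fun_div hL hE).add_const
      (polarSlope b (x 2) ^ 2)).sqrt hN.ne'
    exact ⟨_, (hasDerivAt_const (x 1) (1 : ℝ)).fun_div this hn⟩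
  obtain ⟨f₂, hf₂⟩ : ∃ f', HasDerivAt
      (fun t => 1 / √(normalLengthSq b (exp (lam (x 1))) t)) f' (x 2) := by
    have := ((((hasDerivAt_polarForm b (x 2)).fun_pow 2).div_const (exp (lam (x 1)))).fun_add
      ((hasDerivAt_polarSlope b (x 2)).fun_pow 2)).sqrt hN.ne'
    exact ⟨_, (hasDerivAt_const (x 2) (1 : ℝ)).fun_div this hn⟩
  have p11 : pd 1 (fun z => nullNormal γ lam b ε z 1) x =
      ε / √2 * (f₁ * (polarForm b (x 2) / exp (lam (x 1))) +
        1 / √(normalLengthSq b (exp (lam (x 1))) (x 2)) *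
          (-(polarForm b (x 2) * P) / exp (lam (x 1)) ^ 2)) := by
    rw [pd_congr (hev 1)]
    refine pd_eq_of_hasDerivAt ?_
    simpa using (hf₁.fun_mul ((hasDerivAt_const (x 1) (polarForm b (x 2))).fun_div hL hE)).const_mul
      (ε / √2)
  have p21 : pd 2 (fun z => nullNormal γ lam b ε z 1) x =
      ε / √2 * (f₂ * (polarForm b (x 2) / exp (lam (x 1))) +
        1 / √(normalLengthSq b (exp (lam (x 1))) (x 2)) *
          (2 * polarSlope b (x 2) / exp (lam (x 1)))) := by
    rw [pd_congr (hev 1)]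
    refine pd_eq_of_hasDerivAt ?_
    simpa using (hf₂.fun_mul ((hasDerivAt_polarForm b (x 2)).div_const (exp (lam (x 1))))).const_mul
      (ε / √2)
  have p12 : pd 1 (fun z => nullNormal γ lam b ε z 2) x =
      ε / √2 * (f₁ * (polarSlope b (x 2) / x 1) +
        1 / √(normalLengthSq b (exp (lam (x 1))) (x 2)) * (-polarSlope b (x 2) / x 1 ^ 2)) := by
    rw [pd_congr (hev 2)]
    refine pd_eq_of_hasDerivAt ?_
    simpa using (hf₁.fun_mul ((hasDerivAt_const (x 1) (polarSlope b (x 2))).fun_div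
      (hasDerivAt_id (x 1)) hR')).const_mul (ε / √2)
  have p22 : pd 2 (fun z => nullNormal γ lam b ε z 2) x =
      ε / √2 * (f₂ * (polarSlope b (x 2) / x 1) +
        1 / √(normalLengthSq b (exp (lam (x 1))) (x 2)) *
          ((1 - 1 / b ^ 2) * (cos (x 2) ^ 2 - sin (x 2) ^ 2) / x 1)) := by
    rw [pd_congr (hev 2)]
    refine pd_eq_of_hasDerivAt ?_
    simpa using (hf₂.fun_mul ((hasDerivAt_polarSlope b (x 2)).div_const (x 1))).const_mul
      (ε / √2)
  have p31 : pd 3 (fun z => nullNormal γ lam b ε z 1) x = 0 := by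
    rw [pd_congr (hev 1)]; simp [pd]
  have p32 : pd 3 (fun z => nullNormal γ lam b ε z 2) x = 0 := by
    rw [pd_congr (hev 2)]; simp [pd]
  have p3 : ∀ i, pd i (fun z => nullNormal γ lam b ε z 3) x = 0 := fun i => by
    rw [pd_congr (hev 3)]; simp [pd]
  rw [ip_covDeriv_staticMetric hR hS hγ hL _ _ _ _ _ _ _
    (by rw [nullNormal_eq γ lam b ε hR hS]; rfl), p11, p21, p12, p22, p31, p32, p3, p3, p3,
    nullNormal_eq γ lam b ε hR hS]
  simp only [Matrix.cons_val]
  set n := √(normalLengthSq b (exp (lam (x 1))) (x 2))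
  set Q := polarForm b (x 2)
  set K := polarSlope b (x 2)
  set e := exp (lam (x 1))
  set r := √2 with hr
  have hr0 : r ≠ 0 := by positivity
  linear_combination (norm := (field_simp; ring)) (ε / r * (v₁ * f₁ + v₂ * f₂)) * hw

/-! ### The geometry of the ellipsoids -/

/-- The distance `w` from the origin of the point with parameter `θ` on the ellipsoid `Σ_1`; on
`Σ_a` the area radius is `R = a w`. -/
def profile (b θ : ℝ) : ℝ := √(sin θ ^ 2 + b ^ 2 * cos θ ^ 2)

/-- The function `D` in `σ_θθ = a² D / w²`, where `L = e^λ`. -/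
def metricFactor (b L θ : ℝ) : ℝ := b ^ 2 + L * ((b ^ 2 - 1) * (sin θ * cos θ)) ^ 2

/-- The principal curvature of the ellipsoid along the meridians, where `L = e^λ` and `P` is the
derivative of `e^λ`, both at the area radius `R`. -/
def meridianCurvature (b L P R θ : ℝ) : ℝ :=
  b * √L * (profile b θ ^ 4 + b ^ 2 * (1 / L - 1)
    - R * P / (2 * L) * ((b ^ 2 - 1) * (sin θ * cos θ)) ^ 2) /
    (R * metricFactor b L θ * √(metricFactor b L θ))

/-- The principal curvature of the ellipsoid along the parallels, where `L = e^λ` at the area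
radius `R`. -/
def parallelCurvature (b L R θ : ℝ) : ℝ :=
  b * √L * (profile b θ ^ 2 + 1 / L - 1) / (R * √(metricFactor b L θ))

/-- The sectional curvature of the time slice on the tangent planes of the ellipsoid, with
`L`, `P` and `R` as in `meridianCurvature`. It is the mean of `(1 - e^{-λ}) / R²` and
`λ' e^{-λ} / (2R)`, weighted by the squared components of the unit normal. -/
def ambientCurvature (b L P R θ : ℝ) : ℝ :=
  (b ^ 2 * (1 - 1 / L) + R * P / (2 * L) * ((b ^ 2 - 1) * (sin θ * cos θ)) ^ 2) /
    (metricFactor b L θ * R ^ 2)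

theorem profile_arg_pos {b : ℝ} (hb : 0 < b) (θ : ℝ) : 0 < sin θ ^ 2 + b ^ 2 * cos θ ^ 2 := by
  rcases eq_or_ne (sin θ) 0 with h | h
  · have := sin_sq_add_cos_sq θ
    rw [h] at this ⊢
    have h2 : cos θ ^ 2 = 1 := by linarith
    rw [h2]; positivity
  · positivity

theorem profile_pos {b : ℝ} (hb : 0 < b) (θ : ℝ) : 0 < profile b θ :=
  sqrt_pos.2 (profile_arg_pos hb θ)

theorem profile_sq {b : ℝ} (hb : 0 < b) (θ : ℝ) :
    profile b θ ^ 2 = sin θ ^ 2 + b ^ 2 * cos θ ^ 2 :=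
  sq_sqrt (profile_arg_pos hb θ).le

theorem one_le_profile {b : ℝ} (hb : 1 ≤ b) (θ : ℝ) : 1 ≤ profile b θ := by
  rw [profile, one_le_sqrt]
  have hb2 : 1 ≤ b ^ 2 := one_le_pow₀ hb
  nlinarith [sin_sq_add_cos_sq θ, mul_le_mul_of_nonneg_right hb2 (sq_nonneg (cos θ))]

theorem metricFactor_pos {b L : ℝ} (hb : 0 < b) (hL : 0 < L) (θ : ℝ) :
    0 < metricFactor b L θ := by
  unfold metricFactor; positivity

theorem hasDerivAt_profile {b : ℝ} (hb : 0 < b) (θ : ℝ) :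
    HasDerivAt (profile b) (-((b ^ 2 - 1) * (sin θ * cos θ)) / profile b θ) θ := by
  have h := (((hasDerivAt_sin θ).fun_pow 2).fun_add
    (((hasDerivAt_cos θ).fun_pow 2).const_mul (b ^ 2))).sqrt (profile_arg_pos hb θ).ne'
  refine h.congr_deriv ?_
  have := (profile_pos hb θ).ne'
  rw [← profile]
  field_simp
  ring

/-- In terms of the polar angle `Θ` of the point with parameter `θ`, where `cos Θ = b cos θ / w`, this
is the value of `sin² Θ`. -/
theorem one_sub_cos_ellipsoid_sq {b θ : ℝ} (hb : 0 < b) :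
    1 - (b * cos θ / profile b θ) ^ 2 = (sin θ / profile b θ) ^ 2 := by
  have := (profile_pos hb θ).ne'
  field_simp
  rw [profile_sq hb]
  ring

theorem cos_ellipsoid {t₀ b a : ℝ} (hb : 0 < b) (y : Fin 2 → ℝ) :
    cos (ellipsoid t₀ b a y 2) = b * cos (y 0) / profile b (y 0) := by
  have h : (b * cos (y 0) / profile b (y 0)) ^ 2 ≤ 1 := by
    have := one_sub_cos_ellipsoid_sq (θ := y 0) hb
    nlinarith [sq_nonneg (sin (y 0) / profile b (y 0))]
  have hc := abs_le.1 ((sq_le_one_iff_abs_le_one _).1 h)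
  exact cos_arccos hc.1 hc.2

theorem sin_ellipsoid {t₀ b a : ℝ} (hb : 0 < b) {y : Fin 2 → ℝ} (hy : y 0 ∈ Ioo 0 π) :
    sin (ellipsoid t₀ b a y 2) = sin (y 0) / profile b (y 0) := by
  have hs : 0 < sin (y 0) := sin_pos_of_pos_of_lt_pi hy.1 hy.2
  have hw := profile_pos hb (y 0)
  change sin (arccos (b * cos (y 0) / profile b (y 0))) = _
  rw [sin_arccos, one_sub_cos_ellipsoid_sq hb, sqrt_sq (by positivity)]

theorem tangentVec_ellipsoid_zero (t₀ a : ℝ) {b : ℝ} (hb : 0 < b) {y : Fin 2 → ℝ}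
    (hy : y 0 ∈ Ioo 0 π) :
    tangentVec (ellipsoid t₀ b a) 0 y =
      ![0, -(a * ((b ^ 2 - 1) * (sin (y 0) * cos (y 0))) / profile b (y 0)),
        b / profile b (y 0) ^ 2, 0] := by
  have hs : 0 < sin (y 0) := sin_pos_of_pos_of_lt_pi hy.1 hy.2
  have hw := profile_pos hb (y 0)
  have hu := one_sub_cos_ellipsoid_sq (θ := y 0) hb
  have hpos : 0 < (sin (y 0) / profile b (y 0)) ^ 2 := by positivity
  ext i
  fin_cases i
  · simp [tangentVec, ellipsoid, pd]
  · refine pd_eq_of_hasDerivAt ?_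
    simpa [ellipsoid, profile, mul_div_assoc, neg_div] using
      (hasDerivAt_profile hb (y 0)).const_mul a
  · refine pd_eq_of_hasDerivAt ?_
    have h1 := ((hasDerivAt_cos (y 0)).const_mul b).fun_div (hasDerivAt_profile hb (y 0)) hw.ne'
    have h2 := hasDerivAt_arccos (x := b * cos (y 0) / profile b (y 0))
      (by intro h; rw [h] at hu; norm_num at hu; linarith)
      (by intro h; rw [h] at hu; norm_num at hu; linarith)
    rw [hu, sqrt_sq (by positivity)] at h2
    have h3 := h2.comp (y 0) h1
    have : (fun s => ellipsoid t₀ b a (Function.update y 0 s) 2) =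
        arccos ∘ fun s => b * cos s / profile b s := by
      funext s; simp [ellipsoid, profile]
    simp only [Fin.reduceFinMk]
    rw [this]
    refine h3.congr_deriv ?_
    simp only [Matrix.cons_val]
    field_simp
    rw [profile_sq hb]
    linear_combination sin_sq_add_cos_sq (y 0)
  · simp [tangentVec, ellipsoid, pd]

theorem tangentVec_ellipsoid_one (t₀ b a : ℝ) (y : Fin 2 → ℝ) :
    tangentVec (ellipsoid t₀ b a) 1 y = ![0, 0, 0, 1] := by
  ext i
  fin_cases i <;> simp [tangentVec, ellipsoid, pd]

theorem ellipsoid_one (t₀ b a : ℝ) (y : Fin 2 → ℝ) :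
    ellipsoid t₀ b a y 1 = a * profile b (y 0) := rfl

theorem inducedMetric_ellipsoid (γ lam : ℝ → ℝ) (t₀ a : ℝ) {b : ℝ} (hb : 0 < b) {y : Fin 2 → ℝ}
    (hy : y 0 ∈ Ioo 0 π) :
    inducedMetric (staticMetric γ lam) (ellipsoid t₀ b a) y = Matrix.diagonal
      ![a ^ 2 * metricFactor b (exp (lam (a * profile b (y 0)))) (y 0) / profile b (y 0) ^ 2,
        a ^ 2 * sin (y 0) ^ 2] := by
  have hw := (profile_pos hb (y 0)).ne'
  ext A B
  fin_cases A <;> fin_cases B <;>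
  simp [inducedMetric, ip, Fin.sum_univ_four, tangentVec_ellipsoid_zero t₀ a hb hy,
    tangentVec_ellipsoid_one, staticMetric, ellipsoid_one, sin_ellipsoid hb hy, metricFactor]
  · field_simp
    ring
  · field_simp

theorem areaDensity_ellipsoid (γ lam : ℝ → ℝ) (t₀ a : ℝ) {b : ℝ} (hb : 0 < b) {y : Fin 2 → ℝ}
    (hy : y 0 ∈ Ioo 0 π) :
    areaDensity (staticMetric γ lam) (ellipsoid t₀ b a) y =
      a ^ 2 * (sin (y 0) * √(metricFactor b (exp (lam (a * profile b (y 0)))) (y 0)) /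
        profile b (y 0)) := by
  have hw := profile_pos hb (y 0)
  have hs : 0 < sin (y 0) := sin_pos_of_pos_of_lt_pi hy.1 hy.2
  have hD := metricFactor_pos hb (exp_pos (lam (a * profile b (y 0)))) (y 0)
  have hdet : (∏ i, ![a ^ 2 * metricFactor b (exp (lam (a * profile b (y 0)))) (y 0) /
      profile b (y 0) ^ 2, a ^ 2 * sin (y 0) ^ 2] i) =
      (a ^ 2 * (sin (y 0) * √(metricFactor b (exp (lam (a * profile b (y 0)))) (y 0)) /
        profile b (y 0))) ^ 2 := by
    simp only [Fin.prod_univ_two, Matrix.cons_val, mul_pow, div_pow, sq_sqrt hD.le]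
    ring
  rw [areaDensity, inducedMetric_ellipsoid γ lam t₀ a hb hy, Matrix.det_diagonal, hdet,
    sqrt_sq (by positivity)]

/-- The Gauss equation for the ellipsoid: the scalar curvature is twice the product of the
principal curvatures plus twice the sectional curvature of the time slice. -/
theorem scalarCurvature_ellipsoid {γ lam : ℝ → ℝ} {R₀ : ℝ} (hR₀ : 0 < R₀) (t₀ : ℝ) {a b : ℝ}
    (hb : 1 ≤ b) (ha : R₀ < a) (hlam : DifferentiableOn ℝ lam (Ioi R₀))
    {y : Fin 2 → ℝ} (hy : y 0 ∈ Ioo 0 π) {R L P : ℝ} (hR : R = a * profile b (y 0))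
    (hL : L = exp (lam R)) (hP : P = deriv (fun r => exp (lam r)) R) :
    scalarCurvature (inducedMetric (staticMetric γ lam) (ellipsoid t₀ b a)) y =
      2 * (meridianCurvature b L P R (y 0) * parallelCurvature b L R (y 0)) +
      2 * ambientCurvature b L P R (y 0) := by
  have hb0 : 0 < b := by linarith
  have ha0 : 0 < a := hR₀.trans ha
  have hRmem : ∀ θ, a * profile b θ ∈ Ioi R₀ := by
    intro θ
    have h1 : 1 ≤ profile b θ := one_le_profile hb θ
    exact lt_of_lt_of_le ha (le_mul_of_one_le_right ha0.le h1)
  have hexp : ∀ r ∈ Ioi R₀, HasDerivAt (fun r => exp (lam r)) (deriv (fun r => exp (lam r)) r) r :=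
    fun r hr => ((hlam.differentiableAt (Ioi_mem_nhds hr)).exp).hasDerivAt
  have hE : ∀ θ ∈ Ioo (0 : ℝ) π, HasDerivAt
      (fun θ => a ^ 2 * metricFactor b (exp (lam (a * profile b θ))) θ / profile b θ ^ 2) _ θ :=
    fun θ _ => (((((((hexp _ (hRmem θ)).comp θ ((hasDerivAt_profile hb0 θ).const_mul a)).fun_mul
      ((((hasDerivAt_sin θ).fun_mul (hasDerivAt_cos θ)).const_mul (b ^ 2 - 1)).fun_pow 2)).const_add
      (b ^ 2)).const_mul (a ^ 2)).fun_div ((hasDerivAt_profile hb0 θ).fun_pow 2)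
      (pow_pos (profile_pos hb0 θ) 2).ne'))
  have hG : ∀ θ ∈ Ioo (0 : ℝ) π, HasDerivAt (fun θ => a ^ 2 * sin θ ^ 2)
      (a ^ 2 * (2 * sin θ * cos θ)) θ := by
    intro θ _
    simpa using ((hasDerivAt_sin θ).fun_pow 2).const_mul (a ^ 2)
  have hG₁ : HasDerivAt (fun θ => a ^ 2 * (2 * sin θ * cos θ))
      (a ^ 2 * (2 * cos (y 0) ^ 2 - 2 * sin (y 0) ^ 2)) (y 0) := by
    refine ((((hasDerivAt_sin (y 0)).const_mul 2).fun_mul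
      (hasDerivAt_cos (y 0))).const_mul (a ^ 2)).congr_deriv ?_
    ring
  have hs : 0 < sin (y 0) := sin_pos_of_pos_of_lt_pi hy.1 hy.2
  have hw := profile_pos hb0 (y 0)
  have hLpos : 0 < L := hL ▸ exp_pos _
  have hD := metricFactor_pos hb0 hLpos (y 0)
  rw [scalarCurvature_rotational isOpen_Ioo
    (fun z hz => inducedMetric_ellipsoid γ lam t₀ a hb0 hz) ?_ ?_ hE hG hy hG₁]
  · simp only [Function.comp_def, ← hR, ← hL, ← hP, meridianCurvature, parallelCurvature,
      ambientCurvature]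
    have hDdef : b ^ 2 + L * ((b ^ 2 - 1) * (sin (y 0) * cos (y 0))) ^ 2 = metricFactor b L (y 0) :=
      rfl
    have hd := sqrt_pos.2 hD
    have hd2 := sq_sqrt hD.le
    have hl := sqrt_pos.2 hLpos
    have hl2 := sq_sqrt hLpos.le
    have hw2 := profile_sq hb0 (y 0)
    have hsc := sin_sq_add_cos_sq (y 0)
    simp only [hDdef]
    generalize √(metricFactor b L (y 0)) = d at *
    generalize metricFactor b L (y 0) = D at *
    generalize √L = l at *
    generalize profile b (y 0) = w at *
    generalize sin (y 0) = s at *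
    generalize cos (y 0) = c at *
    subst hR
    clear hE hG hG₁
    subst hd2 hl2
    field_simp
    -- After division by `sin² θ` the equation is polynomial in `w²`, `sin² θ`, `cos² θ` and `D`.
    have key : ∀ W S C L p D : ℝ, S = 1 - C → W = 1 + (b ^ 2 - 1) * C →
        D = b ^ 2 + L * ((b ^ 2 - 1) ^ 2 * (S * C)) →
        L * (2 * D * W ^ 2 - p * C ^ 2 * S * (b ^ 2 - 1) ^ 3 * W
          + 2 * W ^ 2 * L * C * (b ^ 2 - 1) ^ 2 * (C - S) + 2 * C * D * (b ^ 2 - 1) * W) =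
        b ^ 2 * (2 * (W ^ 2 * L + b ^ 2 * (1 - L)) - p * C * S * (b ^ 2 - 1) ^ 2) * (W * L + 1 - L)
          + D * (2 * b ^ 2 * (L - 1) + p * C * S * (b ^ 2 - 1) ^ 2) := by
      rintro W S C L p D rfl rfl rfl
      ring
    have hk := key (w ^ 2) (s ^ 2) (c ^ 2) (l ^ 2) (a * w * P) (d ^ 2) (by linarith)
      (by rw [hw2]; linear_combination hsc) (by rw [← hDdef]; ring)
    norm_num
    linear_combination s ^ 2 * hk
  · intro θ hθ
    have := profile_pos hb0 θ
    have := metricFactor_pos hb0 (exp_pos (lam (a * profile b θ))) θ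
    positivity
  · intro θ hθ
    have := sin_pos_of_pos_of_lt_pi hθ.1 hθ.2
    positivity

/-! ### The null expansions, the shear and the anholonomicity of the ellipsoids -/

theorem polarForm_ellipsoid {t₀ a b : ℝ} (hb : 0 < b) {y : Fin 2 → ℝ} (hy : y 0 ∈ Ioo 0 π) :
    polarForm b (ellipsoid t₀ b a y 2) = 1 / profile b (y 0) ^ 2 := by
  have hw := (profile_pos hb (y 0)).ne'
  rw [polarForm, sin_ellipsoid hb hy, cos_ellipsoid hb]
  field_simp
  exact sin_sq_add_cos_sq (y 0)

theorem polarSlope_ellipsoid {t₀ a b : ℝ} (hb : 0 < b) {y : Fin 2 → ℝ} (hy : y 0 ∈ Ioo 0 π) :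
    polarSlope b (ellipsoid t₀ b a y 2) =
      (b ^ 2 - 1) * (sin (y 0) * cos (y 0)) / (b * profile b (y 0) ^ 2) := by
  have hw := (profile_pos hb (y 0)).ne'
  rw [polarSlope, sin_ellipsoid hb hy, cos_ellipsoid hb]
  field_simp

theorem sqrt_normalLengthSq_ellipsoid {t₀ a b L : ℝ} (hb : 0 < b) (hL : 0 < L) {y : Fin 2 → ℝ}
    (hy : y 0 ∈ Ioo 0 π) :
    √(normalLengthSq b L (ellipsoid t₀ b a y 2)) =
      √(metricFactor b L (y 0)) / (√L * b * profile b (y 0) ^ 2) := by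
  have hw := profile_pos hb (y 0)
  have hD := metricFactor_pos hb hL (y 0)
  have : normalLengthSq b L (ellipsoid t₀ b a y 2) =
      (√(metricFactor b L (y 0)) / (√L * b * profile b (y 0) ^ 2)) ^ 2 := by
    rw [normalLengthSq, polarForm_ellipsoid hb hy, polarSlope_ellipsoid hb hy,
      div_pow _ (√L * _ * _), mul_pow, mul_pow, sq_sqrt hL.le, sq_sqrt hD.le, metricFactor]
    field_simp
  rw [this, sqrt_sq (by positivity)]

/-- The second fundamental form of `Σ_a` is diagonal, with the principal curvatures as
eigenvalues. -/
theorem nullForm_ellipsoid {γ lam : ℝ → ℝ} (t₀ : ℝ) {a b γ' P : ℝ} (ε : ℝ) (ha : 0 < a)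
    (hb : 0 < b) {y : Fin 2 → ℝ} (hy : y 0 ∈ Ioo 0 π) {R L : ℝ}
    (hR : R = a * profile b (y 0)) (hL : L = exp (lam R))
    (hγ : HasDerivAt γ γ' R) (hP : HasDerivAt (fun r => exp (lam r)) P R) (A B : Fin 2) :
    nullForm (staticMetric γ lam) (ellipsoid t₀ b a) (nullNormal γ lam b ε) A B y =
      ε / √2 * Matrix.diagonal
        ![meridianCurvature b L P R (y 0) *
            (a ^ 2 * metricFactor b L (y 0) / profile b (y 0) ^ 2),
          parallelCurvature b L R (y 0) * (a ^ 2 * sin (y 0) ^ 2)] A B := by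
  have hs : 0 < sin (y 0) := sin_pos_of_pos_of_lt_pi hy.1 hy.2
  have hw := profile_pos hb (y 0)
  have hLpos : 0 < L := hL ▸ exp_pos _
  have hD := metricFactor_pos hb hLpos (y 0)
  have hx1 : ellipsoid t₀ b a y 1 = R := by rw [hR]; rfl
  have hR0 : 0 < R := by rw [hR]; positivity
  have hS : 0 < sin (ellipsoid t₀ b a y 2) := by rw [sin_ellipsoid hb hy]; positivity
  have hmain := fun v₁ v₂ v₃ w₁ w₂ w₃ h => ip_covDeriv_nullNormal (γ := γ) (lam := lam)
    (x := ellipsoid t₀ b a y) (γ' := γ') (P := P) b ε (hx1 ▸ hR0) hS (hx1 ▸ hγ) (hx1 ▸ hP)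
    v₁ v₂ v₃ w₁ w₂ w₃ h
  rw [hx1, ← hL, polarForm_ellipsoid hb hy, polarSlope_ellipsoid hb hy,
    sqrt_normalLengthSq_ellipsoid hb hLpos hy, sin_ellipsoid hb hy, cos_ellipsoid hb] at hmain
  have hDdef : metricFactor b L (y 0) = b ^ 2 + L * ((b ^ 2 - 1) * (sin (y 0) * cos (y 0))) ^ 2 :=
    rfl
  have hd := sqrt_pos.2 hD
  have hd2 := sq_sqrt hD.le
  have hl := sqrt_pos.2 hLpos
  have hl2 := sq_sqrt hLpos.le
  have hw2 := profile_sq hb (y 0)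
  have hsc := sin_sq_add_cos_sq (y 0)
  have hr : √2 ≠ 0 := by positivity
  fin_cases A <;> fin_cases B <;>
  simp only [nullForm, tangentVec_ellipsoid_zero t₀ a hb hy, tangentVec_ellipsoid_one,
    Fin.zero_eta, Fin.mk_one, Fin.isValue]
  · rw [hmain _ _ _ _ _ _ (by rw [hR]; field_simp; ring)]
    simp only [meridianCurvature, Matrix.diagonal_apply_eq, Matrix.cons_val]
    clear hmain
    generalize √(metricFactor b L (y 0)) = d at *
    generalize metricFactor b L (y 0) = D at *
    generalize √L = l at *
    generalize profile b (y 0) = w at *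
    generalize sin (y 0) = s at *
    generalize cos (y 0) = c at *
    generalize √2 = r at *
    subst hR hd2 hl2
    field_simp
    have key : ∀ W S C : ℝ, S = 1 - C → W = 1 + (b ^ 2 - 1) * C →
        -((b ^ 2 - 1) ^ 2 * (S * C)) + (b ^ 2 - 1) * (b ^ 2 * C - S) = W ^ 2 - b ^ 2 := by
      rintro W S C rfl rfl
      ring
    have hk := key (w ^ 2) (s ^ 2) (c ^ 2) (by linarith) (by rw [hw2]; linear_combination hsc)
    linear_combination 2 * ε * l ^ 2 * hk
  · rw [hmain _ _ _ _ _ _ (by ring)]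
    simp
  · rw [hmain _ _ _ _ _ _ (by rw [hR]; field_simp; ring)]
    simp
  · rw [hmain _ _ _ _ _ _ (by ring)]
    simp only [parallelCurvature, Matrix.diagonal_apply_eq, Matrix.cons_val]
    clear hmain
    generalize √(metricFactor b L (y 0)) = d at *
    generalize metricFactor b L (y 0) = D at *
    generalize √L = l at *
    generalize profile b (y 0) = w at *
    generalize sin (y 0) = s at *
    generalize cos (y 0) = c at *
    generalize √2 = r at *
    subst hR hd2 hl2
    field_simp
    have hk : w ^ 2 = 1 + (b ^ 2 - 1) * c ^ 2 := by rw [hw2]; linear_combination hsc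
    linear_combination -(2 * ε * b ^ 2 * s ^ 2 * a * l ^ 2) * hk

/-- `[l_+, l_-] = -[e_0, e_1]` is a multiple of `∂_t`, since nothing depends on `t`. -/
theorem lieBracket_nullNormal (γ lam : ℝ → ℝ) (b : ℝ) {x : Fin 4 → ℝ} (hR : 0 < x 1)
    (hS : 0 < sin (x 2)) {k : Fin 4} (hk : k ≠ 0) :
    lieBracket (nullNormal γ lam b 1) (nullNormal γ lam b (-1)) x k = 0 := by
  have hev := fun ε : ℝ => fun k : Fin 4 => (show (fun z => nullNormal γ lam b ε z k) =ᶠ[𝓝 x] _ by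
    filter_upwards [(isOpen_exterior 0).mem_nhds ⟨hR, hS⟩] with z hz using
      congrFun (nullNormal_eq γ lam b ε hz.1 hz.2) k)
  have h0 : ∀ ε, pd 0 (fun z => nullNormal γ lam b ε z k) x = 0 := by
    intro ε
    rw [pd_congr (hev ε k)]
    fin_cases k <;> simp [pd] at hk ⊢
  have hneg : ∀ i, pd i (fun z => nullNormal γ lam b (-1) z k) x =
      -pd i (fun z => nullNormal γ lam b 1 z k) x := by
    intro i
    rw [pd_congr (hev _ k), pd_congr (hev _ k), pd, pd, ← deriv.fun_neg]
    congr 1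
    funext s
    fin_cases k <;> simp [neg_div] at hk ⊢
  simp only [lieBracket, hneg, Fin.sum_univ_four]
  rw [h0, nullNormal_eq γ lam b _ hR hS, nullNormal_eq γ lam b _ hR hS]
  simp
  ring

theorem anholonomicitySq_ellipsoid (γ lam : ℝ → ℝ) (t₀ : ℝ) {a b : ℝ} (ha : 0 < a)
    (hb : 0 < b) {y : Fin 2 → ℝ} (hy : y 0 ∈ Ioo 0 π) :
    anholonomicitySq (staticMetric γ lam) (ellipsoid t₀ b a) (nullNormal γ lam b 1)
      (nullNormal γ lam b (-1)) y = 0 := by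
  have hs : 0 < sin (y 0) := sin_pos_of_pos_of_lt_pi hy.1 hy.2
  have hw := profile_pos hb (y 0)
  have hR : 0 < ellipsoid t₀ b a y 1 := mul_pos ha hw
  have hS : 0 < sin (ellipsoid t₀ b a y 2) := by rw [sin_ellipsoid hb hy]; positivity
  have hω : ∀ A, anholonomicity (staticMetric γ lam) (ellipsoid t₀ b a) (nullNormal γ lam b 1)
      (nullNormal γ lam b (-1)) A y = 0 := by
    intro A
    fin_cases A <;>
    simp [anholonomicity, ip, Fin.sum_univ_four, tangentVec_ellipsoid_zero t₀ a hb hy,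
      tangentVec_ellipsoid_one, staticMetric, lieBracket_nullNormal γ lam b hR hS]
  simp [anholonomicitySq, hω]

/-- The integrands of the two masses. The product of the expansions is `-(κ₁ + κ₂)² / 2`, that of the
shears is `-(κ₁ - κ₂)²`, so that in the Hayward mass the Gauss equation cancels all of the extrinsic
curvature. -/
theorem integrand_ellipsoid {γ lam : ℝ → ℝ} {R₀ : ℝ} (hR₀ : 0 < R₀) (t₀ : ℝ) {a b : ℝ}
    (hb : 1 ≤ b) (ha : R₀ < a) (hγ : DifferentiableOn ℝ γ (Ioi R₀))
    (hlam : DifferentiableOn ℝ lam (Ioi R₀))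
    {y : Fin 2 → ℝ} (hy : y 0 ∈ Ioo 0 π) {R L P : ℝ} (hR : R = a * profile b (y 0))
    (hL : L = exp (lam R)) (hP : P = deriv (fun r => exp (lam r)) R) :
    haywardIntegrand (staticMetric γ lam) (ellipsoid t₀ b a)
        (outgoingNormal γ lam b) (ingoingNormal γ lam b) y = 2 * ambientCurvature b L P R (y 0) ∧
    hawkingIntegrand (staticMetric γ lam) (ellipsoid t₀ b a)
        (outgoingNormal γ lam b) (ingoingNormal γ lam b) y = 2 * ambientCurvature b L P R (y 0) -
      (meridianCurvature b L P R (y 0) - parallelCurvature b L R (y 0)) ^ 2 / 2 := by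
  have hb0 : 0 < b := by linarith
  have ha0 : 0 < a := hR₀.trans ha
  have hRmem : R ∈ Ioi R₀ := by
    rw [hR]
    exact lt_of_lt_of_le ha (le_mul_of_one_le_right ha0.le (one_le_profile hb _))
  have hγ' := (hγ.differentiableAt (Ioi_mem_nhds hRmem)).hasDerivAt
  have hexp : HasDerivAt (fun r => exp (lam r)) P R :=
    hP ▸ ((hlam.differentiableAt (Ioi_mem_nhds hRmem)).exp).hasDerivAt
  have hs : 0 < sin (y 0) := sin_pos_of_pos_of_lt_pi hy.1 hy.2
  have hw := profile_pos hb0 (y 0)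
  have hLpos : 0 < L := hL ▸ exp_pos _
  have hD := metricFactor_pos hb0 hLpos (y 0)
  have hσ : inducedMetric (staticMetric γ lam) (ellipsoid t₀ b a) y = _ :=
    inducedMetric_ellipsoid γ lam t₀ a hb0 hy
  rw [← hR, ← hL] at hσ
  have hnull := fun ε A B => nullForm_ellipsoid t₀ ε ha0 hb0 hy hR hL hγ' hexp A B
  set E := a ^ 2 * metricFactor b L (y 0) / profile b (y 0) ^ 2 with hE
  set G := a ^ 2 * sin (y 0) ^ 2 with hG
  have hE0 : E ≠ 0 := by positivity
  have hG0 : G ≠ 0 := by positivity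
  have hσi : (inducedMetric (staticMetric γ lam) (ellipsoid t₀ b a) y)⁻¹ =
      Matrix.diagonal ![E⁻¹, G⁻¹] := by
    rw [hσ, inv_diagonal_of_ne_zero]
    · congr 1; ext i; fin_cases i <;> rfl
    · intro i; fin_cases i
      · exact hE0
      · exact hG0
  have hK := scalarCurvature_ellipsoid (γ := γ) hR₀ t₀ hb ha hlam hy hR hL hP
  have hω := anholonomicitySq_ellipsoid γ lam t₀ ha0 hb0 hy
  set κ₁ := meridianCurvature b L P R (y 0)
  set κ₂ := parallelCurvature b L R (y 0)
  -- `ρ` stands for `1 / √2`.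
  obtain ⟨ρ, hρ, hρ2⟩ : ∃ ρ : ℝ, (∀ ε, ε / √2 = ε * ρ) ∧ ρ ^ 2 = 1 / 2 :=
    ⟨1 / √2, fun ε => by ring, by rw [div_pow, sq_sqrt zero_le_two, one_pow]⟩
  simp only [hρ] at hnull
  have hθ : ∀ ε, expansion (staticMetric γ lam) (ellipsoid t₀ b a) (nullNormal γ lam b ε) y =
      ε * ρ * (κ₁ + κ₂) := by
    intro ε
    simp [expansion, Fin.sum_univ_two, hσi, hnull]
    field_simp
  have hprod : expansion (staticMetric γ lam) (ellipsoid t₀ b a) (nullNormal γ lam b 1) y *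
      expansion (staticMetric γ lam) (ellipsoid t₀ b a) (nullNormal γ lam b (-1)) y =
      -(κ₁ + κ₂) ^ 2 / 2 := by
    rw [hθ, hθ]
    linear_combination -(κ₁ + κ₂) ^ 2 * hρ2
  have hshear : shearProduct (staticMetric γ lam) (ellipsoid t₀ b a) (nullNormal γ lam b 1)
      (nullNormal γ lam b (-1)) y = -(κ₁ - κ₂) ^ 2 := by
    simp only [shearProduct, hσi, shear]
    simp [Fin.sum_univ_two, hσ, hnull, hθ]
    linear_combination (norm := (field_simp; ring)) -2 * (κ₁ - κ₂) ^ 2 * hρ2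
  rw [outgoingNormal_eq, ingoingNormal_eq, haywardIntegrand, hawkingIntegrand, hK, hprod, hshear,
    hω]
  constructor <;> ring

/-! ### Integrals over the parameter domain -/

theorem isOpen_angles : IsOpen angles :=
  (isOpen_Ioo.preimage (continuous_apply (0 : Fin 2))).inter
    (isOpen_Ioo.preimage (continuous_apply (1 : Fin 2)))

theorem volume_angles_lt_top : volume angles < ⊤ := by
  have : angles ⊆ Icc (fun _ => 0) (fun _ => 2 * π) := by
    intro y hy
    have hπ := pi_pos
    obtain ⟨⟨h1, h2⟩, h3, h4⟩ := hy
    refine ⟨fun i => ?_, fun i => ?_⟩ <;> fin_cases i <;> simp <;> linarith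
  exact (measure_mono this).trans_lt isCompact_Icc.measure_lt_top

theorem setIntegral_angles (f : ℝ → ℝ) :
    ∫ y in angles, f (y 0) = 2 * π * ∫ θ in (0 : ℝ)..π, f θ := by
  have hpre : angles = MeasurableEquiv.finTwoArrow ⁻¹' (Ioo (0 : ℝ) π ×ˢ Ioo (0 : ℝ) (2 * π)) := rfl
  have hmap : ∫ y in angles, f (y 0) = ∫ z in Ioo (0 : ℝ) π ×ˢ Ioo (0 : ℝ) (2 * π), f z.1 := by
    rw [hpre]
    exact (volume_preserving_finTwoArrow ℝ).setIntegral_preimage_emb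
      (MeasurableEquiv.measurableEmbedding _) (fun z : ℝ × ℝ => f z.1) _
  rw [hmap]
  have := setIntegral_prod_mul (μ := volume) (ν := volume) f (fun _ : ℝ => (1 : ℝ))
    (Ioo (0 : ℝ) π) (Ioo (0 : ℝ) (2 * π))
  simp only [mul_one] at this
  rw [Measure.volume_eq_prod, this, intervalIntegral.integral_of_le pi_pos.le,
    integral_Ioc_eq_integral_Ioo]
  simp [pi_pos.le]
  ring

/-- Dominated convergence for integrals over `Σ_a` of a continuous function of `θ` and of
quantities `p(R)` that converge as `R → ∞`. It applies since `R = a w(θ) ≥ a` on all of `Σ_a`. -/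
theorem tendsto_setIntegral_angles {X : Type*} [TopologicalSpace X] [LocallyCompactSpace X]
    {U : Set X} (hU : IsOpen U) {F : ℝ → X → ℝ}
    (hF : ContinuousOn (Function.uncurry F) (univ ×ˢ U)) {p : ℝ → X} {q : X} {R₀ b : ℝ}
    (hp : ContinuousOn p (Ioi R₀)) (hpU : MapsTo p (Ioi R₀) U) (hlim : Tendsto p atTop (𝓝 q))
    (hq : q ∈ U) (hb : 1 ≤ b) :
    (∀ᶠ a in atTop, IntegrableOn (fun y => F (y 0) (p (a * profile b (y 0)))) angles) ∧
    Tendsto (fun a => ∫ y in angles, F (y 0) (p (a * profile b (y 0)))) atTop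
      (𝓝 (∫ y in angles, F (y 0) q)) := by
  have hb0 : 0 < b := by linarith
  have hw : Continuous (profile b) := by unfold profile; fun_prop
  obtain ⟨K, hKn, hKU, hK⟩ := local_compact_nhds (hU.mem_nhds hq)
  obtain ⟨C, hC⟩ := (isCompact_Icc.prod hK).exists_bound_of_continuousOn
    (hF.mono (prod_mono (subset_univ (Icc (0 : ℝ) π)) hKU))
  obtain ⟨a₀, ha₀⟩ := eventually_atTop.1 (hlim.eventually hKn)
  have hle : ∀ {a : ℝ}, 0 < a → ∀ θ, a ≤ a * profile b θ := fun ha θ =>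
    le_mul_of_one_le_right ha.le (one_le_profile hb θ)
  have hmeas : ∀ᶠ a in atTop, AEStronglyMeasurable
      (fun y : Fin 2 → ℝ => F (y 0) (p (a * profile b (y 0)))) (volume.restrict angles) := by
    filter_upwards [eventually_gt_atTop R₀, eventually_gt_atTop 0] with a ha ha0
    refine ContinuousOn.aestronglyMeasurable ?_ isOpen_angles.measurableSet
    have hmaps : ∀ y : Fin 2 → ℝ, a * profile b (y 0) ∈ Ioi R₀ := fun y =>
      lt_of_lt_of_le ha (hle ha0 _)
    have hc : Continuous fun y : Fin 2 → ℝ => a * profile b (y 0) :=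
      continuous_const.mul (hw.comp (continuous_apply 0))
    exact hF.comp ((continuous_apply 0).continuousOn.prodMk
      (hp.comp hc.continuousOn fun y _ => hmaps y)) fun y _ => ⟨mem_univ _, hpU (hmaps y)⟩
  have hbound : ∀ᶠ a in atTop, ∀ᵐ y ∂(volume.restrict angles),
      ‖F (y 0) (p (a * profile b (y 0)))‖ ≤ C := by
    filter_upwards [eventually_ge_atTop a₀, eventually_gt_atTop 0] with a ha ha0
    filter_upwards [ae_restrict_mem isOpen_angles.measurableSet] with y hy
    exact hC (y 0, p (a * profile b (y 0)))
      ⟨Ioo_subset_Icc_self hy.1, ha₀ _ (ha.trans (hle ha0 _))⟩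
  have hfin : IsFiniteMeasure (volume.restrict angles) :=
    isFiniteMeasure_restrict.2 volume_angles_lt_top.ne
  constructor
  · filter_upwards [hmeas, hbound] with a h1 h2
    exact Integrable.of_bound h1 C h2
  · refine tendsto_integral_filter_of_dominated_convergence (fun _ => C) hmeas hbound
      (integrable_const C) (Eventually.of_forall fun y => ?_)
    have h1 : Tendsto (fun a => a * profile b (y 0)) atTop atTop :=
      tendsto_id.atTop_mul_const (profile_pos hb0 _)
    have h2 : ContinuousAt (Function.uncurry F) (y 0, q) :=
      hF.continuousAt ((isOpen_univ.prod hU).mem_nhds ⟨mem_univ _, hq⟩)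
    exact h2.tendsto.comp (tendsto_const_nhds.prodMk_nhds (hlim.comp h1))

/-! ### The area of a spheroid -/

theorem metricFactor_one {b : ℝ} (hb : 0 < b) (θ : ℝ) :
    metricFactor b 1 θ = profile b θ ^ 2 * (b ^ 2 - (b ^ 2 - 1) * cos θ ^ 2) := by
  rw [profile_sq hb, metricFactor]
  have hs : sin θ ^ 2 = 1 - cos θ ^ 2 := by linarith [sin_sq_add_cos_sq θ]
  rw [mul_pow, mul_pow, hs]
  ring

theorem sub_mul_cos_sq_pos {b : ℝ} (hb : 1 ≤ b) (θ : ℝ) :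
    0 < b ^ 2 - (b ^ 2 - 1) * cos θ ^ 2 := by
  have hb2 : 1 ≤ b ^ 2 := one_le_pow₀ hb
  nlinarith [cos_sq_le_one θ]

/-- The area of the spheroid with semi-axes `1`, `1`, `b`, divided by `2π`. -/
theorem integral_sin_mul_sqrt {b : ℝ} (hb : 1 ≤ b) :
    ∫ θ in (0 : ℝ)..π, sin θ * √(b ^ 2 - (b ^ 2 - 1) * cos θ ^ 2) = 1 + arcsinTerm b := by
  rcases hb.eq_or_lt with rfl | hb1
  · norm_num [arcsinTerm]
  have hb0 : 0 < b := by linarith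
  have hk : 0 < b ^ 2 - 1 := by nlinarith
  have hr := sqrt_pos.2 hk
  have hr2 := sq_sqrt hk.le
  set r := √(b ^ 2 - 1) with hr_def
  -- The antiderivative of `√(b² - (b² - 1) x²)`, at `x = cos θ`.
  have hder : ∀ θ ∈ uIcc 0 π, HasDerivAt (fun θ => -(cos θ *
      √(b ^ 2 - (b ^ 2 - 1) * cos θ ^ 2) / 2 + b ^ 2 / (2 * r) * arcsin (r * cos θ / b)))
      (sin θ * √(b ^ 2 - (b ^ 2 - 1) * cos θ ^ 2)) θ := by
    intro θ _
    have hpos := sub_mul_cos_sq_pos hb θ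
    have h1 := ((((hasDerivAt_cos θ).fun_pow 2).const_mul (b ^ 2 - 1)).const_sub (b ^ 2)).sqrt
      hpos.ne'
    have hx : 1 - (r * cos θ / b) ^ 2 = (√(b ^ 2 - (b ^ 2 - 1) * cos θ ^ 2) / b) ^ 2 := by
      rw [div_pow, div_pow, sq_sqrt hpos.le, mul_pow, hr2]
      field_simp
    have hxpos : 0 < 1 - (r * cos θ / b) ^ 2 := by
      rw [hx]; have := sqrt_pos.2 hpos; positivity
    have h2 := (hasDerivAt_arcsin (x := r * cos θ / b)
      (by intro h; rw [h] at hxpos; norm_num at hxpos)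
      (by intro h; rw [h] at hxpos; norm_num at hxpos)).comp θ
      (((hasDerivAt_cos θ).const_mul r).div_const b)
    have hq := sqrt_pos.2 hpos
    have hq2 := sq_sqrt hpos.le
    rw [hx, sqrt_sq (by positivity)] at h2
    have h3 := ((((hasDerivAt_cos θ).fun_mul h1).div_const 2).fun_add
      (h2.const_mul (b ^ 2 / (2 * r)))).fun_neg
    refine h3.congr_deriv ?_
    generalize √(b ^ 2 - (b ^ 2 - 1) * cos θ ^ 2) = q at *
    field_simp
    norm_num
    linear_combination -2 * sin θ * hq2
  rw [intervalIntegral.integral_eq_sub_of_hasDerivAt hder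
    ((by fun_prop : Continuous _).intervalIntegrable _ _), arcsinTerm, if_neg hb1.ne',
    sqrt_div hk.le, sqrt_sq hb0.le]
  simp [neg_div]
  field_simp
  ring

/-! ### The rescaled integrands and their limits -/

/-- The quantities `(e^λ, R (e^λ - 1), R² (e^λ)', R (e^λ)')` on which the integrands depend. -/
def radialData (lam : ℝ → ℝ) (R : ℝ) : ℝ × ℝ × ℝ × ℝ :=
  (exp (lam R), R * (exp (lam R) - 1), R ^ 2 * deriv (fun r => exp (lam r)) R,
    R * deriv (fun r => exp (lam r)) R)

/-- The area density of `Σ_a`, divided by `a²`. -/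
def areaProfile (b θ : ℝ) (p : ℝ × ℝ × ℝ × ℝ) : ℝ :=
  sin θ * √(metricFactor b p.1 θ) / profile b θ

/-- The integrand of the Hayward mass times the area density, multiplied by `a`. -/
def haywardProfile (b θ : ℝ) (p : ℝ × ℝ × ℝ × ℝ) : ℝ :=
  2 * ((b ^ 2 * p.2.1 / p.1 +
    p.2.2.1 / (2 * p.1) * ((b ^ 2 - 1) * (sin θ * cos θ)) ^ 2) /
    (metricFactor b p.1 θ * profile b θ ^ 3)) * areaProfile b θ p

/-- Half the squared difference of the principal curvatures, times the area density. It does not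
scale with `a`. -/
def shearProfile (b θ : ℝ) (p : ℝ × ℝ × ℝ × ℝ) : ℝ :=
  (meridianCurvature b p.1 p.2.2.2 1 θ - parallelCurvature b p.1 1 θ) ^ 2 / (2 * profile b θ ^ 2) *
    areaProfile b θ p

theorem isOpen_positive_fst : IsOpen {p : ℝ × ℝ × ℝ × ℝ | 0 < p.1} :=
  isOpen_lt continuous_const continuous_fst

theorem continuousOn_metricFactor (b : ℝ) (s : Set (ℝ × ℝ × ℝ × ℝ × ℝ)) :
    ContinuousOn (fun z : ℝ × ℝ × ℝ × ℝ × ℝ => metricFactor b z.2.1 z.1) s := by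
  unfold metricFactor; fun_prop

theorem continuousOn_profile (b : ℝ) (s : Set (ℝ × ℝ × ℝ × ℝ × ℝ)) :
    ContinuousOn (fun z : ℝ × ℝ × ℝ × ℝ × ℝ => profile b z.1) s := by
  unfold profile; fun_prop

theorem continuousOn_areaProfile {b : ℝ} (hb : 0 < b) :
    ContinuousOn (Function.uncurry (areaProfile b)) (univ ×ˢ {p | 0 < p.1}) :=
  ((continuous_sin.comp continuous_fst).continuousOn.mul
    (continuousOn_metricFactor b _).sqrt).div (continuousOn_profile b _)
    fun z _ => (profile_pos hb z.1).ne'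

theorem continuousOn_haywardProfile {b : ℝ} (hb : 0 < b) :
    ContinuousOn (Function.uncurry (haywardProfile b)) (univ ×ˢ {p | 0 < p.1}) := by
  refine ContinuousOn.mul (ContinuousOn.mul continuousOn_const (ContinuousOn.div ?_
    ((continuousOn_metricFactor b _).mul ((continuousOn_profile b _).pow 3)) ?_))
    (continuousOn_areaProfile hb)
  · refine ContinuousOn.add (ContinuousOn.div (by fun_prop) (by fun_prop) ?_)
      (ContinuousOn.mul (ContinuousOn.div (by fun_prop) (by fun_prop) ?_) (by fun_prop))
    · rintro z ⟨-, hz⟩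
      exact hz.ne'
    · rintro z ⟨-, hz⟩
      exact mul_ne_zero two_ne_zero hz.ne'
  · rintro z ⟨-, hz⟩
    exact (mul_pos (metricFactor_pos hb hz _) (pow_pos (profile_pos hb _) 3)).ne'

theorem continuousOn_shearProfile {b : ℝ} (hb : 0 < b) :
    ContinuousOn (Function.uncurry (shearProfile b)) (univ ×ˢ {p | 0 < p.1}) := by
  have hD := continuousOn_metricFactor b (univ ×ˢ {p | 0 < p.1})
  have hw := continuousOn_profile b (univ ×ˢ {p | 0 < p.1})
  have hone : ContinuousOn (fun z : ℝ × ℝ × ℝ × ℝ × ℝ => 1 / z.2.1) (univ ×ˢ {p | 0 < p.1}) :=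
    ContinuousOn.div (by fun_prop) (by fun_prop) (by rintro z ⟨-, hz⟩; exact hz.ne')
  have hl : ContinuousOn (fun z : ℝ × ℝ × ℝ × ℝ × ℝ => b * √z.2.1) (univ ×ˢ {p | 0 < p.1}) := by
    fun_prop
  refine ContinuousOn.mul (ContinuousOn.div (ContinuousOn.pow (ContinuousOn.sub ?_ ?_) 2)
    (continuousOn_const.mul (hw.pow 2)) fun z _ => ?_) (continuousOn_areaProfile hb)
  · refine ContinuousOn.div (hl.mul (ContinuousOn.sub ((hw.pow 4).add
      (continuousOn_const.mul (hone.sub continuousOn_const)))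
      (ContinuousOn.mul (ContinuousOn.div (by fun_prop) (by fun_prop) ?_) (by fun_prop))))
      ((continuousOn_const.mul hD).mul hD.sqrt) ?_
    · rintro z ⟨-, hz⟩
      exact mul_ne_zero two_ne_zero hz.ne'
    · rintro z ⟨-, hz⟩
      have := metricFactor_pos hb hz z.1
      have := sqrt_pos.2 this
      positivity
  · refine ContinuousOn.div (hl.mul (((hw.pow 2).add hone).sub continuousOn_const))
      (continuousOn_const.mul hD.sqrt) ?_
    rintro z ⟨-, hz⟩
    have := sqrt_pos.2 (metricFactor_pos hb hz z.1)
    positivity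
  · have := profile_pos hb z.1
    positivity

theorem continuousOn_radialData {lam : ℝ → ℝ} {R₀ : ℝ} (hlam : ContDiffOn ℝ 2 lam (Ioi R₀)) :
    ContinuousOn (radialData lam) (Ioi R₀) := by
  have hexp : ContDiffOn ℝ 2 (fun r => exp (lam r)) (Ioi R₀) := hlam.exp
  have hd := hexp.continuousOn_deriv_of_isOpen isOpen_Ioi (by norm_num)
  have hc := hexp.continuousOn
  exact hc.prodMk ((continuousOn_id.mul (hc.sub continuousOn_const)).prodMk
    (((continuousOn_id.pow 2).mul hd).prodMk (continuousOn_id.mul hd)))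

theorem tendsto_mul_of_isBigO {f : ℝ → ℝ} {c : ℝ} {n : ℕ}
    (h : (fun R : ℝ => f R - c / R ^ n) =O[atTop] fun R : ℝ => 1 / R ^ (n + 1)) :
    Tendsto (fun R => R ^ n * f R) atTop (𝓝 c) := by
  have h1 : (fun R : ℝ => R ^ n * (f R - c / R ^ n)) =O[atTop]
      fun R : ℝ => R ^ n * (1 / R ^ (n + 1)) := (isBigO_refl _ _).mul h
  have h2 : Tendsto (fun R : ℝ => R ^ n * (1 / R ^ (n + 1))) atTop (𝓝 0) := by
    refine tendsto_inv_atTop_zero.congr' ?_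
    filter_upwards [eventually_gt_atTop 0] with R hR
    field_simp
    ring
  have h3 := (h1.trans_tendsto h2).add_const c
  rw [zero_add] at h3
  refine h3.congr' ?_
  filter_upwards [eventually_gt_atTop 0] with R hR
  field_simp
  ring

theorem tendsto_radialData {lam : ℝ → ℝ} {m : ℝ}
    (hdecay : (fun R : ℝ => exp (lam R) - (1 + 2 * m / R)) =O[atTop] fun R : ℝ => 1 / R ^ 2)
    (hdecay_deriv : (fun R : ℝ => deriv (fun r => exp (lam r)) R - (-2 * m / R ^ 2)) =O[atTop]
      fun R : ℝ => 1 / R ^ 3) :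
    Tendsto (radialData lam) atTop (𝓝 (1, 2 * m, -2 * m, 0)) := by
  have hu : Tendsto (fun R => R * (exp (lam R) - 1)) atTop (𝓝 (2 * m)) := by
    have := tendsto_mul_of_isBigO (f := fun R => exp (lam R) - 1) (c := 2 * m) (n := 1) (by
      refine hdecay.congr_left fun R => ?_
      ring)
    simpa using this
  have hv := tendsto_mul_of_isBigO hdecay_deriv
  have hL : Tendsto (fun R => exp (lam R)) atTop (𝓝 1) := by
    have := (hu.mul tendsto_inv_atTop_zero).add_const 1
    rw [mul_zero, zero_add] at this
    refine this.congr' ?_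
    filter_upwards [eventually_gt_atTop 0] with R hR
    field_simp
    ring
  have hz : Tendsto (fun R => R * deriv (fun r => exp (lam r)) R) atTop (𝓝 0) := by
    have := hv.mul tendsto_inv_atTop_zero
    rw [mul_zero] at this
    refine this.congr' ?_
    filter_upwards [eventually_gt_atTop 0] with R hR
    field_simp
  exact hL.prodMk_nhds (hu.prodMk_nhds (hv.prodMk_nhds hz))

theorem integral_areaProfile {b : ℝ} (hb : 1 ≤ b) (p : ℝ × ℝ × ℝ) :
    ∫ y in angles, areaProfile b (y 0) (1, p) = 2 * π * (1 + arcsinTerm b) := by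
  have hb0 : 0 < b := by linarith
  rw [setIntegral_angles (fun θ => areaProfile b θ (1, p)), ← integral_sin_mul_sqrt hb]
  congr 2
  funext θ
  have hw := profile_pos hb0 θ
  simp only [areaProfile]
  rw [metricFactor_one hb0, sqrt_mul (by positivity), sqrt_sq hw.le]
  field_simp

theorem integral_haywardProfile {b : ℝ} (hb : 1 ≤ b) (m : ℝ) :
    ∫ y in angles, haywardProfile b (y 0) (1, 2 * m, -2 * m, 0) =
      2 * π * (2 * √2 * m * ∫ θ in (0 : ℝ)..π,
          (2 * b ^ 2 - (1 - b ^ 2) ^ 2 * sin θ ^ 2 * cos θ ^ 2) * sin θ /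
            (√(1 + b ^ 2 + (1 - b ^ 2) * cos (2 * θ)) *
              (b ^ 2 * cos θ ^ 2 + sin θ ^ 2) ^ (5 / 2 : ℝ))) := by
  have hb0 : 0 < b := by linarith
  rw [setIntegral_angles (fun θ => haywardProfile b θ (1, 2 * m, -2 * m, 0)),
    ← intervalIntegral.integral_const_mul (2 * √2 * m)]
  congr 2
  funext θ
  have hw := profile_pos hb0 θ
  have hY := sub_mul_cos_sq_pos hb θ
  have hy := sqrt_pos.2 hY
  have hy2 := sq_sqrt hY.le
  have h1 : 1 + b ^ 2 + (1 - b ^ 2) * cos (2 * θ) = 2 * (b ^ 2 - (b ^ 2 - 1) * cos θ ^ 2) := by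
    rw [cos_two_mul]; ring
  have h2 : (b ^ 2 * cos θ ^ 2 + sin θ ^ 2) ^ (5 / 2 : ℝ) = profile b θ ^ 5 := by
    rw [add_comm, ← profile_sq hb0, ← rpow_natCast, ← rpow_natCast, ← rpow_mul hw.le]
    norm_num
  simp only [haywardProfile, areaProfile]
  rw [h1, h2, sqrt_mul zero_le_two, metricFactor_one hb0, sqrt_mul (by positivity), sqrt_sq hw.le]
  have hr : 0 < √2 := by positivity
  nth_rewrite 1 [← hy2]
  field_simp
  ring

/-- In flat space the ellipsoid with `b > 1` is umbilic only at its poles. -/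
theorem integral_shearProfile_pos {b : ℝ} (hb : 1 < b) (u v : ℝ) :
    0 < ∫ y in angles, shearProfile b (y 0) (1, u, v, 0) := by
  have hb0 : 0 < b := by linarith
  rw [setIntegral_angles (fun θ => shearProfile b θ (1, u, v, 0))]
  refine mul_pos (by positivity) (intervalIntegral.intervalIntegral_pos_of_pos_on ?_ ?_ pi_pos)
  · refine Continuous.intervalIntegrable ?_ _ _
    have := (continuousOn_shearProfile hb0).comp_continuous
      (f := fun θ : ℝ => (θ, ((1 : ℝ), u, v, (0 : ℝ)))) (by fun_prop)
      (fun θ => ⟨mem_univ _, by simp⟩)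
    exact this
  · intro θ hθ
    have hs := sin_pos_of_pos_of_lt_pi hθ.1 hθ.2
    have hw := profile_pos hb0 θ
    have hD := metricFactor_pos hb0 one_pos θ
    have hd := sqrt_pos.2 hD
    have hk : 0 < b ^ 2 - 1 := by nlinarith
    have hne : meridianCurvature b 1 0 1 θ - parallelCurvature b 1 1 θ ≠ 0 := by
      have hlt : profile b θ ^ 2 < metricFactor b 1 θ := by
        rw [metricFactor_one hb0]
        have : 1 < b ^ 2 - (b ^ 2 - 1) * cos θ ^ 2 := by
          rw [cos_sq']
          nlinarith [mul_pos hk (pow_pos hs 2)]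
        exact lt_mul_of_one_lt_right (by positivity) this
      have : meridianCurvature b 1 0 1 θ - parallelCurvature b 1 1 θ =
          b * profile b θ ^ 2 * (profile b θ ^ 2 - metricFactor b 1 θ) /
            (metricFactor b 1 θ * √(metricFactor b 1 θ)) := by
        simp only [meridianCurvature, parallelCurvature]
        simp
        field_simp
      rw [this]
      have h3 : profile b θ ^ 2 - metricFactor b 1 θ ≠ 0 := by linarith
      positivity
    simp only [shearProfile, areaProfile]
    positivity

/-! ### The masses in terms of the rescaled integrands -/

theorem areaDensity_eq_areaProfile (γ lam : ℝ → ℝ) (t₀ a : ℝ) {b : ℝ} (hb : 1 ≤ b)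
    {y : Fin 2 → ℝ} (hy : y ∈ angles) :
    areaDensity (staticMetric γ lam) (ellipsoid t₀ b a) y =
      a ^ 2 * areaProfile b (y 0) (radialData lam (a * profile b (y 0))) :=
  areaDensity_ellipsoid γ lam t₀ a (by linarith) hy.1

/-- The integrands of both masses, rescaled. The powers of `a` show that the Hayward integrand
contributes to the mass at order `a⁰`, but the shear term, which only the Hawking mass retains, at
order `a¹`. -/
theorem integrand_mul_areaDensity {γ lam : ℝ → ℝ} {R₀ : ℝ} (hR₀ : 0 < R₀) (t₀ : ℝ) {a b : ℝ}
    (hb : 1 ≤ b) (ha : R₀ < a) (hγ : DifferentiableOn ℝ γ (Ioi R₀))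
    (hlam : DifferentiableOn ℝ lam (Ioi R₀)) {y : Fin 2 → ℝ} (hy : y ∈ angles) :
    haywardIntegrand (staticMetric γ lam) (ellipsoid t₀ b a)
        (outgoingNormal γ lam b) (ingoingNormal γ lam b) y *
      areaDensity (staticMetric γ lam) (ellipsoid t₀ b a) y =
        a⁻¹ * haywardProfile b (y 0) (radialData lam (a * profile b (y 0))) ∧
    hawkingIntegrand (staticMetric γ lam) (ellipsoid t₀ b a)
        (outgoingNormal γ lam b) (ingoingNormal γ lam b) y *
      areaDensity (staticMetric γ lam) (ellipsoid t₀ b a) y =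
        a⁻¹ * haywardProfile b (y 0) (radialData lam (a * profile b (y 0))) -
          shearProfile b (y 0) (radialData lam (a * profile b (y 0))) := by
  have hb0 : 0 < b := by linarith
  have ha0 : 0 < a := hR₀.trans ha
  obtain ⟨h1, h2⟩ := integrand_ellipsoid hR₀ t₀ hb ha hγ hlam hy.1 rfl rfl rfl
  rw [areaDensity_eq_areaProfile γ lam t₀ a hb hy, h1, h2]
  have hw := profile_pos hb0 (y 0)
  have hL := exp_pos (lam (a * profile b (y 0)))
  have hD := metricFactor_pos hb0 hL (y 0)
  have hd := sqrt_pos.2 hD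
  simp only [haywardProfile, shearProfile, ambientCurvature, meridianCurvature, parallelCurvature,
    radialData]
  generalize areaProfile b (y 0) _ = A
  generalize deriv (fun r => exp (lam r)) (a * profile b (y 0)) = P
  generalize exp (lam (a * profile b (y 0))) = L at *
  generalize profile b (y 0) = w at *
  generalize √(metricFactor b L (y 0)) = d at *
  generalize metricFactor b L (y 0) = D at *
  have e1 : 2 * ((b ^ 2 * (1 - 1 / L) +
      a * w * P / (2 * L) * ((b ^ 2 - 1) * (sin (y 0) * cos (y 0))) ^ 2) / (D * (a * w) ^ 2)) *
      (a ^ 2 * A) = a⁻¹ * (2 * ((b ^ 2 * (a * w * (L - 1)) / L + (a * w) ^ 2 * P / (2 * L) *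
        ((b ^ 2 - 1) * (sin (y 0) * cos (y 0))) ^ 2) / (D * w ^ 3)) * A) := by
    field_simp
  refine ⟨e1, ?_⟩
  rw [sub_mul, e1]
  congr 1
  field_simp

end QuasiLocal

end

theorem mainTheorem1 (γ lam : ℝ → ℝ) (R₀ m b t₀ : ℝ) (hR₀ : 0 < R₀) (hb : 1 ≤ b)
    (hγ : ContDiffOn ℝ 2 γ (Ioi R₀)) (hlam : ContDiffOn ℝ 2 lam (Ioi R₀))
    (hdecay : (fun R : ℝ => exp (lam R) - (1 + 2 * m / R)) =O[atTop] fun R : ℝ => 1 / R ^ 2)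
    (hdecay_deriv : (fun R : ℝ => deriv (fun r => exp (lam r)) R - (-2 * m / R ^ 2)) =O[atTop]
      fun R : ℝ => 1 / R ^ 3) :
    (∀ᶠ a in atTop,
      IntegrableOn (QuasiLocal.areaDensity (QuasiLocal.staticMetric γ lam)
        (QuasiLocal.ellipsoid t₀ b a)) QuasiLocal.angles ∧
      IntegrableOn (fun y =>
        QuasiLocal.haywardIntegrand (QuasiLocal.staticMetric γ lam) (QuasiLocal.ellipsoid t₀ b a)
          (QuasiLocal.outgoingNormal γ lam b) (QuasiLocal.ingoingNormal γ lam b) y *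
        QuasiLocal.areaDensity (QuasiLocal.staticMetric γ lam) (QuasiLocal.ellipsoid t₀ b a) y)
        QuasiLocal.angles) ∧
    Tendsto (fun a => QuasiLocal.ellipsoidHaywardMass γ lam t₀ b a) atTop
      (𝓝 (m / 4 * √(1 + QuasiLocal.arcsinTerm b) *
        ∫ θ in (0 : ℝ)..π,
          (2 * b ^ 2 - (1 - b ^ 2) ^ 2 * sin θ ^ 2 * cos θ ^ 2) * sin θ /
            (√(1 + b ^ 2 + (1 - b ^ 2) * cos (2 * θ)) *
              (b ^ 2 * cos θ ^ 2 + sin θ ^ 2) ^ (5 / 2 : ℝ)))) ∧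
    (1 < b → Tendsto (fun a => QuasiLocal.ellipsoidHawkingMass γ lam t₀ b a) atTop atBot) := by
  open QuasiLocal in
  have hb0 : 0 < b := by linarith
  have hang := isOpen_angles.measurableSet
  have hγd := hγ.differentiableOn (by norm_num)
  have hlamd := hlam.differentiableOn (by norm_num)
  have hpU : MapsTo (radialData lam) (Ioi R₀) {p | 0 < p.1} := fun R _ => exp_pos (lam R)
  have hq : (1, 2 * m, -2 * m, 0) ∈ {p : ℝ × ℝ × ℝ × ℝ | 0 < p.1} := by simp
  have hlim := tendsto_radialData hdecay hdecay_deriv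
  have hp := continuousOn_radialData hlam
  obtain ⟨hAi, hA⟩ := tendsto_setIntegral_angles isOpen_positive_fst
    (continuousOn_areaProfile hb0) hp hpU hlim hq hb
  obtain ⟨hHi, hH⟩ := tendsto_setIntegral_angles isOpen_positive_fst
    (continuousOn_haywardProfile hb0) hp hpU hlim hq hb
  obtain ⟨hSi, hS⟩ := tendsto_setIntegral_angles isOpen_positive_fst
    (continuousOn_shearProfile hb0) hp hpU hlim hq hb
  rw [integral_areaProfile hb] at hA
  rw [integral_haywardProfile hb] at hH
  set Ai := fun a => ∫ y in angles, areaProfile b (y 0) (radialData lam (a * profile b (y 0)))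
  set Hi := fun a => ∫ y in angles, haywardProfile b (y 0) (radialData lam (a * profile b (y 0)))
  set Si := fun a => ∫ y in angles, shearProfile b (y 0) (radialData lam (a * profile b (y 0)))
  set I := ∫ θ in (0 : ℝ)..π,
          (2 * b ^ 2 - (1 - b ^ 2) ^ 2 * sin θ ^ 2 * cos θ ^ 2) * sin θ /
            (√(1 + b ^ 2 + (1 - b ^ 2) * cos (2 * θ)) *
              (b ^ 2 * cos θ ^ 2 + sin θ ^ 2) ^ (5 / 2 : ℝ))
  have harea : ∀ᶠ a in atTop, √(area (staticMetric γ lam) (ellipsoid t₀ b a) angles / (16 * π)) =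
      a * √(Ai a / (16 * π)) := by
    filter_upwards [eventually_gt_atTop 0] with a ha
    rw [area, setIntegral_congr_fun hang
      fun y hy => areaDensity_eq_areaProfile γ lam t₀ a hb hy, integral_const_mul, mul_div_assoc,
      sqrt_mul (by positivity), sqrt_sq ha.le]
  have hhay : ∀ᶠ a in atTop, 1 / (8 * π) * √(Ai a / (16 * π)) * Hi a =
      ellipsoidHaywardMass γ lam t₀ b a := by
    filter_upwards [eventually_gt_atTop 0, eventually_gt_atTop R₀, harea] with a ha0 ha h
    rw [ellipsoidHaywardMass, haywardMass, h, setIntegral_congr_fun hang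
      fun y hy => (integrand_mul_areaDensity hR₀ t₀ hb ha hγd hlamd hy).1, integral_const_mul]
    field_simp
    rfl
  -- The Hawking mass is the Hayward mass minus `a` times a quantity with a positive limit if `1 < b`.
  have hhaw : ∀ᶠ a in atTop, 1 / (8 * π) * √(Ai a / (16 * π)) * Hi a +
      a * -(1 / (8 * π) * √(Ai a / (16 * π)) * Si a) = ellipsoidHawkingMass γ lam t₀ b a := by
    filter_upwards [eventually_gt_atTop 0, eventually_gt_atTop R₀, harea, hHi, hSi]
      with a ha0 ha h hHia hSia
    rw [ellipsoidHawkingMass, hawkingMass, h, setIntegral_congr_fun hang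
      fun y hy => (integrand_mul_areaDensity hR₀ t₀ hb ha hγd hlamd hy).2,
      integral_sub (hHia.const_mul _) hSia, integral_const_mul]
    change _ = 1 / (8 * π) * (a * √(Ai a / (16 * π))) * (a⁻¹ * Hi a - Si a)
    field_simp
    ring
  have hsqrt : Tendsto (fun a => 1 / (8 * π) * √(Ai a / (16 * π))) atTop
      (𝓝 (1 / (8 * π) * √(2 * π * (1 + arcsinTerm b) / (16 * π)))) :=
    (hA.div_const _).sqrt.const_mul _
  have hHayward := (hsqrt.mul hH).congr' hhay
  have hconst : √(2 * π * (1 + arcsinTerm b) / (16 * π)) = √(1 + arcsinTerm b) / (2 * √2) := by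
    have h8 : √8 = 2 * √2 := by
      rw [show (8 : ℝ) = 2 ^ 2 * 2 by norm_num, sqrt_mul (by norm_num), sqrt_sq zero_le_two]
    rw [← h8, ← sqrt_div' _ (by norm_num)]
    congr 1
    field_simp
    ring
  refine ⟨?_, ?_, fun hb1 => ?_⟩
  · filter_upwards [eventually_gt_atTop R₀, hAi, hHi] with a ha hAia hHia
    exact ⟨IntegrableOn.congr_fun (hAia.const_mul (a ^ 2))
        (fun y hy => (areaDensity_eq_areaProfile γ lam t₀ a hb hy).symm) hang,
      IntegrableOn.congr_fun (hHia.const_mul a⁻¹)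
        (fun y hy => (integrand_mul_areaDensity hR₀ t₀ hb ha hγd hlamd hy).1.symm) hang⟩
  · convert hHayward using 2
    rw [hconst]
    field_simp
    ring
  · have hSpos := integral_shearProfile_pos hb1 (2 * m) (-2 * m)
    have harc : 0 < 1 + arcsinTerm b := by
      have : 0 ≤ arcsin √((b ^ 2 - 1) / b ^ 2) := arcsin_nonneg.2 (sqrt_nonneg _)
      rw [arcsinTerm, if_neg hb1.ne']
      positivity
    have hneg : -(1 / (8 * π) * √(2 * π * (1 + arcsinTerm b) / (16 * π)) *
        ∫ y in angles, shearProfile b (y 0) (1, 2 * m, -2 * m, 0)) < 0 := by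
      have : 0 < √(2 * π * (1 + arcsinTerm b) / (16 * π)) := sqrt_pos.2 (by positivity)
      rw [neg_lt_zero]
      positivity
    exact ((hsqrt.mul hH).add_atBot (tendsto_id.atTop_mul_neg hneg (hsqrt.mul hS).neg)).congr' hhaw
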